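/- Let $I=(0,1)$. For $\ell\ge 0$ let $A_\ell$ be the set of immersed planar curves $\gamma\in H^2(I;\mathbf{R}^2)$ (identified with their $C^1([0,1])$ representatives, immersed meaning $\min_{[0,1]}|\gamma'|>0$) with $\gamma(0)=(0,0)$ and $\gamma(1)=(\ell,0)$. Write $s$ for the arclength parameter, $\partial_s=|\gamma'|^{-1}\partial_x$, and $\kappa=\partial_s^2\gamma$ for the curvature vector. Let $\theta\in H^1(I)$ be a tangential angle function, $\partial_s\gamma=(\cos\theta,\sin\theta)$, let $k=\partial_s\theta$ be the signed curvature, and let $TC[\gamma]=\int_\gamma k\,ds$ be the total signed curvature. Let $E[\gamma]=B[\gamma]+L[\gamma]=\int_\gamma|\kappa|^2\,ds+\int_\gamma ds$. Then for every $\ell\ge0$ and every $r\in\mathbf{R}$ there exists a minimizer of $E$ in $$A_\ell^r:=\{\gamma\in A_\ell \mid TC[\gamma]=r\},$$ that is, there is $\gamma\in A_\ell^r$ with $E[\gamma]\le E[\eta]$ for all $\eta\in A_\ell^r$. -/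

import Mathlib

open MeasureTheory Set
open scoped ContDiff

namespace PlanarElastica

/-- The Euclidean plane. -/
abbrev Plane : Type := EuclideanSpace ℝ (Fin 2)

section Sobolev

variable {F : Type*} [NormedAddCommGroup F] [NormedSpace ℝ F]

/-- `g` is a weak (distributional) derivative of `f` on the interval `I = (0, 1)`:
both are locally integrable on `I` and `∫_I φ' f = - ∫_I φ g` for every `φ ∈ C_c^∞(I)`.
Only the values of `f` and `g` on `I` matter. -/
structure IsWeakDeriv (f g : ℝ → F) : Prop where
  locallyIntegrableOn_left : LocallyIntegrableOn f (Ioo (0 : ℝ) 1)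
  locallyIntegrableOn_right : LocallyIntegrableOn g (Ioo (0 : ℝ) 1)
  integral_eq : ∀ φ : ℝ → ℝ, ContDiff ℝ ∞ φ → HasCompactSupport φ → tsupport φ ⊆ Ioo 0 1 →
    ∫ x in Ioo (0 : ℝ) 1, deriv φ x • f x = - ∫ x in Ioo (0 : ℝ) 1, φ x • g x

/-- The Sobolev space `H^1(I; F)`, `I = (0, 1)`. -/
def MemH1 (f : ℝ → F) : Prop :=
  MemLp f 2 (volume.restrict (Ioo (0 : ℝ) 1)) ∧
    ∃ g : ℝ → F, IsWeakDeriv f g ∧ MemLp g 2 (volume.restrict (Ioo (0 : ℝ) 1))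

/-- The Sobolev space `H^2(I; F)`, `I = (0, 1)`. -/
def MemH2 (f : ℝ → F) : Prop :=
  MemLp f 2 (volume.restrict (Ioo (0 : ℝ) 1)) ∧ ∃ g : ℝ → F, IsWeakDeriv f g ∧ MemH1 g

open Classical in
/-- The weak derivative of `f` on `I = (0, 1)`; it is determined almost everywhere on `I`
(see `weakDeriv_ae_eq`). The value is `0` if `f` has no weak derivative. -/
noncomputable def weakDeriv (f : ℝ → F) : ℝ → F :=
  if h : ∃ g : ℝ → F, IsWeakDeriv f g then h.choose else 0

/-- The weak derivative does not depend on the choice made in its definition. -/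
theorem weakDeriv_ae_eq [CompleteSpace F] {f g : ℝ → F} (h : IsWeakDeriv f g) :
    weakDeriv f =ᵐ[volume.restrict (Ioo (0 : ℝ) 1)] g := by
  have hex : ∃ g : ℝ → F, IsWeakDeriv f g := ⟨g, h⟩
  have h' : IsWeakDeriv f (weakDeriv f) := by
    unfold weakDeriv
    rw [dif_pos hex]
    exact hex.choose_spec
  have hint : ∀ u : ℝ → F, LocallyIntegrableOn u (Ioo (0 : ℝ) 1) → ∀ φ : ℝ → ℝ,
      Continuous φ → HasCompactSupport φ → tsupport φ ⊆ Ioo 0 1 →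
      IntegrableOn (fun x => φ x • u x) (Ioo (0 : ℝ) 1) := by
    intro u hu φ hφ hc hs
    have h1 : IntegrableOn (fun x => φ x • u x) (tsupport φ) :=
      (hu.integrableOn_compact_subset hs hc).continuousOn_smul hφ.continuousOn hc
    refine Integrable.integrableOn ((integrableOn_iff_integrable_of_support_subset ?_).mp h1)
    intro x hx
    refine subset_tsupport φ ?_
    intro h0
    exact hx (by simp [h0])
  have key : ∀ᵐ x ∂(volume : Measure ℝ), x ∈ Ioo (0 : ℝ) 1 → (weakDeriv f - g) x = 0 := by
    refine isOpen_Ioo.ae_eq_zero_of_integral_contDiff_smul_eq_zero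
      (h'.locallyIntegrableOn_right.sub h.locallyIntegrableOn_right) ?_
    intro φ hφ hc hs
    have e1 := h'.integral_eq φ hφ hc hs
    have e2 := h.integral_eq φ hφ hc hs
    have e3 : ∫ x in Ioo (0 : ℝ) 1, φ x • (weakDeriv f - g) x = 0 := by
      simp only [Pi.sub_apply, smul_sub]
      rw [integral_sub (hint _ h'.locallyIntegrableOn_right φ hφ.continuous hc hs)
        (hint _ h.locallyIntegrableOn_right φ hφ.continuous hc hs)]
      rw [e1] at e2
      rw [neg_inj.mp e2, sub_self]
    rw [← e3, setIntegral_eq_integral_of_forall_compl_eq_zero]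
    intro x hx
    have h0 : φ x = 0 := by
      by_contra h0
      exact hx (hs (subset_tsupport φ h0))
    simp [h0]
  filter_upwards [ae_restrict_of_ae key, ae_restrict_mem measurableSet_Ioo] with x hx hxm
  exact sub_eq_zero.mp (hx hxm)

end Sobolev

/-- The derivative `γ' = ∂ₓγ` of a `C^1` curve on `[0, 1]` (one-sided at the endpoints). -/
noncomputable def velocity (γ : ℝ → Plane) (x : ℝ) : Plane :=
  derivWithin γ (Icc (0 : ℝ) 1) x

/-- The set `H^2_imm(I; ℝ²)` of immersed `H^2` planar curves, each element of `H^2` being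
represented by its `C^1([0, 1])` representative, with `min_{[0,1]} |γ'| > 0`.
Only the values of `γ` on `[0, 1]` matter. -/
def H2Imm : Set (ℝ → Plane) :=
  {γ | MemH2 γ ∧ ContDiffOn ℝ 1 γ (Icc (0 : ℝ) 1) ∧
    ∃ c : ℝ, 0 < c ∧ ∀ x ∈ Icc (0 : ℝ) 1, c ≤ ‖velocity γ x‖}

/-- The unit tangent `∂ₛγ = γ' / |γ'|`. -/
noncomputable def unitTangent (γ : ℝ → Plane) (x : ℝ) : Plane :=
  ‖velocity γ x‖⁻¹ • velocity γ x

/-- The curvature vector `κ = ∂ₛ²γ = ∂ₛ(∂ₛγ)`, where `∂ₛ = |γ'|⁻¹ ∂ₓ` (weak derivative). -/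
noncomputable def curvatureVector (γ : ℝ → Plane) (x : ℝ) : Plane :=
  ‖velocity γ x‖⁻¹ • weakDeriv (unitTangent γ) x

/-- The length `L[γ] = ∫_γ ds`. -/
noncomputable def length (γ : ℝ → Plane) : ℝ :=
  ∫ x in Ioo (0 : ℝ) 1, ‖velocity γ x‖

/-- The bending energy `B[γ] = ∫_γ |κ|² ds`. -/
noncomputable def bendingEnergy (γ : ℝ → Plane) : ℝ :=
  ∫ x in Ioo (0 : ℝ) 1, ‖curvatureVector γ x‖ ^ 2 * ‖velocity γ x‖

/-- The energy `E = B + L`. -/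
noncomputable def energy (γ : ℝ → Plane) : ℝ :=
  bendingEnergy γ + length γ

/-- `θ ∈ H^1(I)` (continuous representative on `[0, 1]`) is a tangential angle function of `γ`:
`∂ₛγ = (cos θ, sin θ)`. -/
def IsTangentialAngle (γ : ℝ → Plane) (θ : ℝ → ℝ) : Prop :=
  MemH1 θ ∧ ContinuousOn θ (Icc (0 : ℝ) 1) ∧
    ∀ x ∈ Icc (0 : ℝ) 1, unitTangent γ x = !₂[Real.cos (θ x), Real.sin (θ x)]

open Classical in
/-- A tangential angle function of `γ`. For an immersed `H^2` curve it exists and is unique up to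
adding a constant in `2πℤ`. -/
noncomputable def tangentialAngle (γ : ℝ → Plane) : ℝ → ℝ :=
  if h : ∃ θ : ℝ → ℝ, IsTangentialAngle γ θ then h.choose else 0

/-- The signed curvature `k = ∂ₛθ`, where `∂ₛ = |γ'|⁻¹ ∂ₓ`. -/
noncomputable def signedCurvature (γ : ℝ → Plane) (x : ℝ) : ℝ :=
  ‖velocity γ x‖⁻¹ * weakDeriv (tangentialAngle γ) x

/-- The total signed curvature `TC[γ] = ∫_γ k ds`. -/
noncomputable def totalCurvature (γ : ℝ → Plane) : ℝ :=
  ∫ x in Ioo (0 : ℝ) 1, signedCurvature γ x * ‖velocity γ x‖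

/-- The class `A_ℓ` of immersed `H^2` curves with `γ(0) = (0, 0)` and `γ(1) = (ℓ, 0)`. -/
def admissible (ℓ : ℝ) : Set (ℝ → Plane) :=
  {γ | γ ∈ H2Imm ∧ γ 0 = !₂[0, 0] ∧ γ 1 = !₂[ℓ, 0]}

/-- The class `A_ℓ^r` of curves in `A_ℓ` with total signed curvature `r`. -/
def admissibleTC (ℓ r : ℝ) : Set (ℝ → Plane) :=
  {γ | γ ∈ admissible ℓ ∧ totalCurvature γ = r}

end PlanarElastica

/-! The proof is the direct method, applied after a reduction that removes both the freedom of
parametrisation and the pointwise endpoint constraint. In the parametrisation proportional to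
arclength a curve is determined, up to a rigid motion, by its length `L` and the derivative `v ∈
L²(0,1)` of its tangential angle. Its energy is then `(∫ v²) / L + L`, its total curvature is `∫ v`,
and since `ℓ ≥ 0` a rotation and a translation place the endpoints correctly as soon as they have
distance `ℓ`. These conditions form `IsFeasible`. The passages
`exists_isFeasible_of_mem_admissibleTC` and `IsFeasible.exists_mem_admissibleTC` both preserve the
energy exactly, so minimising `arcEnergy` suffices.

Along a minimising sequence with energies at most `M`, one has `L ≤ M` and `∫ v² ≤ M L ≤ M²`. The
one danger is that `L` tends to zero. For `ℓ > 0` this is excluded because an arc is at least as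
long as its chord. For `ℓ = 0` a closed arc has to turn, which forces `∫ v² > 1`, so the bending
energy exceeds `1 / L` (`IsFeasible.inv_le_arcEnergy`). Weak compactness in `L²` gives a limit.
Angles are integrals of `v`, so they converge pointwise, both constraints pass to the limit, and the
norm is weakly lower semicontinuous (`exists_arcEnergy_minimizer`).

The feasible set is nonempty by an explicit family of angles, odd about the midpoint, and the
intermediate value theorem (`exists_isFeasible`). -/

namespace PlanarElastica

/-! ### Calculus of absolutely continuous primitives -/

/-- `f` is on `[0, 1]` a primitive of the integrable function `v`. -/
structure IsPrimitive (f v : ℝ → ℝ) : Prop where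
  intervalIntegrable : IntervalIntegrable v volume 0 1
  eq_add_integral : ∀ x ∈ Icc (0 : ℝ) 1, f x = f 0 + ∫ t in (0 : ℝ)..x, v t

theorem AbsolutelyContinuousOnInterval.congr {f g : ℝ → ℝ} {a b : ℝ}
    (hf : AbsolutelyContinuousOnInterval f a b) (hfg : EqOn f g (uIcc a b)) :
    AbsolutelyContinuousOnInterval g a b := by
  rw [absolutelyContinuousOnInterval_iff] at hf ⊢
  intro ε hε
  obtain ⟨δ, hδ, h⟩ := hf ε hε
  refine ⟨δ, hδ, fun E hE hE' => ?_⟩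
  convert! h E hE hE' using 1
  refine Finset.sum_congr rfl fun i hi => ?_
  rw [hfg (hE.1 i hi).1, hfg (hE.1 i hi).2]

theorem AbsolutelyContinuousOnInterval.lipschitzOnWith_comp {f Φ : ℝ → ℝ} {a b : ℝ} {s : Set ℝ}
    {K : NNReal} (hf : AbsolutelyContinuousOnInterval f a b) (hΦ : LipschitzOnWith K Φ s)
    (hs : MapsTo f (uIcc a b) s) : AbsolutelyContinuousOnInterval (Φ ∘ f) a b := by
  rw [absolutelyContinuousOnInterval_iff] at hf ⊢
  intro ε hε
  obtain ⟨δ, hδ, h⟩ := hf (ε / (K + 1)) (by positivity)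
  refine ⟨δ, hδ, fun E hE hE' => ?_⟩
  calc ∑ i ∈ Finset.range E.1, dist ((Φ ∘ f) (E.2 i).1) ((Φ ∘ f) (E.2 i).2)
      ≤ ∑ i ∈ Finset.range E.1, (K + 1 : ℝ) * dist (f (E.2 i).1) (f (E.2 i).2) := by
        refine Finset.sum_le_sum fun i hi => ?_
        refine (hΦ.dist_le_mul _ (hs (hE.1 i hi).1) _ (hs (hE.1 i hi).2)).trans ?_
        gcongr
        linarith
    _ = (K + 1 : ℝ) * ∑ i ∈ Finset.range E.1, dist (f (E.2 i).1) (f (E.2 i).2) := by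
        rw [Finset.mul_sum]
    _ < (K + 1 : ℝ) * (ε / (K + 1)) := by gcongr; exact h E hE hE'
    _ = ε := by field_simp

namespace IsPrimitive

variable {f g v w : ℝ → ℝ}

theorem absolutelyContinuous (h : IsPrimitive f v) : AbsolutelyContinuousOnInterval f 0 1 := by
  have h1 := h.intervalIntegrable.absolutelyContinuousOnInterval_intervalIntegral (c := 0) (by simp)
  have h2 : AbsolutelyContinuousOnInterval (fun _ : ℝ => f 0) 0 1 :=
    (LipschitzOnWith.of_dist_le_mul (K := 0) (by simp)).absolutelyContinuousOnInterval
  refine AbsolutelyContinuousOnInterval.congr (h2.add h1) fun x hx => ?_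
  rw [uIcc_of_le zero_le_one] at hx
  exact (h.eq_add_integral x hx).symm

theorem continuousOn (h : IsPrimitive f v) : ContinuousOn f (Icc 0 1) := by
  simpa [uIcc_of_le] using h.absolutelyContinuous.continuousOn

theorem ae_hasDerivAt (h : IsPrimitive f v) : ∀ᵐ x, x ∈ Ioo (0 : ℝ) 1 → HasDerivAt f (v x) x := by
  filter_upwards [h.intervalIntegrable.ae_hasDerivAt_integral] with x hx hxI
  have h1 := (hx (by rw [uIcc_of_le zero_le_one]; exact Ioo_subset_Icc_self hxI) 0
    (by simp)).const_add (f 0)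
  refine h1.congr_of_eventuallyEq ?_
  filter_upwards [Ioo_mem_nhds hxI.1 hxI.2] with y hy
  exact h.eq_add_integral y (Ioo_subset_Icc_self hy)

/-- The difference of `f` and the integral of `v` is absolutely continuous with zero derivative
almost everywhere, hence constant. Sum, product and chain rules are all obtained through this
criterion. -/
theorem of_ae_hasDerivAt (hf : AbsolutelyContinuousOnInterval f 0 1)
    (hv : IntervalIntegrable v volume 0 1)
    (h : ∀ᵐ x, x ∈ Ioo (0 : ℝ) 1 → HasDerivAt f (v x) x) : IsPrimitive f v := by
  refine ⟨hv, ?_⟩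
  have hG := hv.absolutelyContinuousOnInterval_intervalIntegral (c := 0) (by simp)
  have h0 : ∀ᵐ x : ℝ, x ≠ 0 := by simp [ae_iff, measure_singleton]
  have h1 : ∀ᵐ x : ℝ, x ≠ 1 := by simp [ae_iff, measure_singleton]
  obtain ⟨C, hC⟩ := (hf.sub hG).const_of_ae_hasDerivAt_zero (by
    filter_upwards [h, hv.ae_hasDerivAt_integral, h0, h1] with x hx hx' hx0 hx1 hxI
    rw [uIcc_of_le zero_le_one] at hxI
    have := (hx ⟨lt_of_le_of_ne hxI.1 hx0.symm, lt_of_le_of_ne hxI.2 hx1⟩).sub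
      (hx' (by rwa [uIcc_of_le zero_le_one]) 0 (by simp))
    simpa using this)
  intro x hx
  have e0 := hC 0 (by simp)
  have ex := hC x (by rwa [uIcc_of_le zero_le_one])
  simp only [Pi.sub_apply, intervalIntegral.integral_same] at e0 ex
  linarith

theorem continuousOn_mul_intervalIntegrable (hf : ContinuousOn f (Icc 0 1))
    (hv : IntervalIntegrable v volume 0 1) :
    IntervalIntegrable (fun x => f x * v x) volume 0 1 :=
  hv.continuousOn_mul (by rwa [uIcc_of_le zero_le_one])

theorem add (hf : IsPrimitive f v) (hg : IsPrimitive g w) :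
    IsPrimitive (fun x => f x + g x) (fun x => v x + w x) := by
  refine of_ae_hasDerivAt (hf.absolutelyContinuous.add hg.absolutelyContinuous)
    (hf.intervalIntegrable.add hg.intervalIntegrable) ?_
  filter_upwards [hf.ae_hasDerivAt, hg.ae_hasDerivAt] with x h1 h2 hx
  exact (h1 hx).add (h2 hx)

theorem mul (hf : IsPrimitive f v) (hg : IsPrimitive g w) :
    IsPrimitive (fun x => f x * g x) (fun x => g x * v x + f x * w x) := by
  refine of_ae_hasDerivAt (hf.absolutelyContinuous.mul hg.absolutelyContinuous)
    ((continuousOn_mul_intervalIntegrable hg.continuousOn hf.intervalIntegrable).add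
      (continuousOn_mul_intervalIntegrable hf.continuousOn hg.intervalIntegrable)) ?_
  filter_upwards [hf.ae_hasDerivAt, hg.ae_hasDerivAt] with x h1 h2 hx
  have := (h1 hx).mul (h2 hx)
  rwa [mul_comm (v x)] at this

/-- A `C¹` function is Lipschitz on a compact interval containing the range of `f`, so the
composition stays absolutely continuous. -/
theorem comp {Φ Φ' : ℝ → ℝ} (hΦ : ∀ x, HasDerivAt Φ (Φ' x) x) (hΦ' : Continuous Φ')
    (hf : IsPrimitive f v) : IsPrimitive (fun x => Φ (f x)) (fun x => Φ' (f x) * v x) := by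
  obtain ⟨M, hM⟩ := isCompact_Icc.exists_bound_of_continuousOn hf.continuousOn
  have hC : ContDiff ℝ 1 Φ := by
    rw [contDiff_one_iff_deriv]
    refine ⟨fun x => (hΦ x).differentiableAt, ?_⟩
    rwa [show deriv Φ = Φ' from funext fun x => (hΦ x).deriv]
  obtain ⟨K, hK⟩ := hC.contDiffOn.exists_lipschitzOnWith one_ne_zero
    (convex_Icc (-M) M) isCompact_Icc
  refine of_ae_hasDerivAt
    (AbsolutelyContinuousOnInterval.lipschitzOnWith_comp hf.absolutelyContinuous hK ?_)
    (continuousOn_mul_intervalIntegrable (hΦ'.comp_continuousOn hf.continuousOn)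
      hf.intervalIntegrable) ?_
  · intro x hx
    rw [uIcc_of_le zero_le_one] at hx
    exact abs_le.1 (hM x hx)
  · filter_upwards [hf.ae_hasDerivAt] with x h1 hx
    exact (hΦ (f x)).comp x (h1 hx)

theorem congr_right (hf : IsPrimitive f v) (h : ∀ x ∈ Icc (0 : ℝ) 1, v x = w x) :
    IsPrimitive f w := by
  refine ⟨hf.intervalIntegrable.congr fun x hx => ?_, fun x hx => ?_⟩
  · rw [uIoc_of_le zero_le_one] at hx
    exact h x (Ioc_subset_Icc_self hx)
  · rw [hf.eq_add_integral x hx]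
    congr 1
    refine intervalIntegral.integral_congr fun t ht => ?_
    rw [uIcc_of_le hx.1] at ht
    exact h t ⟨ht.1, ht.2.trans hx.2⟩

theorem congr_left (hf : IsPrimitive f v) (h : ∀ x ∈ Icc (0 : ℝ) 1, f x = g x) :
    IsPrimitive g v :=
  ⟨hf.intervalIntegrable, fun x hx => by
    rw [← h x hx, ← h 0 (by simp), hf.eq_add_integral x hx]⟩

theorem eq_of_zero (hf : IsPrimitive f v) (h : ∀ x ∈ Icc (0 : ℝ) 1, v x = 0) :
    ∀ x ∈ Icc (0 : ℝ) 1, f x = f 0 := by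
  intro x hx
  have := (hf.congr_right (w := fun _ => 0) h).eq_add_integral x hx
  simpa using this

theorem integral_eq_sub (hf : IsPrimitive f v) : ∫ x in Ioo (0 : ℝ) 1, v x = f 1 - f 0 := by
  have := hf.eq_add_integral 1 (by simp)
  rw [intervalIntegral.integral_of_le zero_le_one, integral_Ioc_eq_integral_Ioo] at this
  linarith

theorem of_integral (c : ℝ) (hv : IntervalIntegrable v volume 0 1) :
    IsPrimitive (fun x => c + ∫ t in (0 : ℝ)..x, v t) v :=
  ⟨hv, by simp⟩

theorem of_contDiffOn (hf : ContDiffOn ℝ 1 f (Icc 0 1)) :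
    IsPrimitive f (derivWithin f (Icc 0 1)) := by
  have hc : ContinuousOn (derivWithin f (Icc 0 1)) (Icc 0 1) :=
    hf.continuousOn_derivWithin (uniqueDiffOn_Icc zero_lt_one) le_rfl
  refine of_ae_hasDerivAt (ContDiffOn.absolutelyContinuousOnInterval
    (by rwa [uIcc_of_le zero_le_one])) (ContinuousOn.intervalIntegrable
    (by rwa [uIcc_of_le zero_le_one])) (.of_forall fun x hx => ?_)
  exact ((hf.differentiableOn one_ne_zero) x
    (Ioo_subset_Icc_self hx)).hasDerivWithinAt.hasDerivAt (Icc_mem_nhds hx.1 hx.2)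

end IsPrimitive
-- Weak derivatives in dimension one
theorem integrable_smul_test {F : Type*} [NormedAddCommGroup F] [NormedSpace ℝ F] {u : ℝ → F}
    (hu : LocallyIntegrableOn u (Ioo (0 : ℝ) 1)) {φ : ℝ → ℝ} (hφ : Continuous φ)
    (hc : HasCompactSupport φ) (hs : tsupport φ ⊆ Ioo 0 1) :
    IntegrableOn (fun x => φ x • u x) (Ioo (0 : ℝ) 1) := by
  have h1 : IntegrableOn (fun x => φ x • u x) (tsupport φ) :=
    (hu.integrableOn_compact_subset hs hc).continuousOn_smul hφ.continuousOn hc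
  refine Integrable.integrableOn ((integrableOn_iff_integrable_of_support_subset ?_).mp h1)
  intro x hx
  refine subset_tsupport φ ?_
  intro h0
  exact hx (by simp [h0])

theorem tsupport_deriv_subset_of_subset {φ : ℝ → ℝ} {s : Set ℝ} (hs : tsupport φ ⊆ s) :
    tsupport (deriv φ) ⊆ s :=
  (closure_minimal support_deriv_subset isClosed_closure).trans hs

/-- The linear embedding of the line as the `i`-th coordinate axis of the plane. -/
noncomputable def axis (i : Fin 2) : ℝ →L[ℝ] Plane :=
  (ContinuousLinearMap.id ℝ ℝ).smulRight (EuclideanSpace.single i (1 : ℝ))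

theorem axis_add (z : Plane) : axis 0 (z 0) + axis 1 (z 1) = z := by
  ext i
  fin_cases i <;> simp [axis]

theorem memLp_coord {f : ℝ → Plane} {μ : Measure ℝ} (h : MemLp f 2 μ)
    (i : Fin 2) : MemLp (fun x => f x i) 2 μ :=
  (EuclideanSpace.proj (𝕜 := ℝ) i : Plane →L[ℝ] ℝ).comp_memLp' h

theorem memLp_of_coord {f : ℝ → Plane} {μ : Measure ℝ}
    (h : ∀ i, MemLp (fun x => f x i) 2 μ) : MemLp f 2 μ := by
  have := ((axis 0).comp_memLp' (h 0)).add ((axis 1).comp_memLp' (h 1))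
  exact this.ae_eq (.of_forall fun x => axis_add (f x))

namespace IsWeakDeriv

section

variable {F G : Type*} [NormedAddCommGroup F] [NormedSpace ℝ F]
  [NormedAddCommGroup G] [NormedSpace ℝ G] {f g f₁ g₁ : ℝ → F}

theorem clm_comp [CompleteSpace F] [CompleteSpace G] (A : F →L[ℝ] G) (h : IsWeakDeriv f g) :
    IsWeakDeriv (fun x => A (f x)) (fun x => A (g x)) := by
  have hloc : ∀ u : ℝ → F, LocallyIntegrableOn u (Ioo (0 : ℝ) 1) →
      LocallyIntegrableOn (fun x => A (u x)) (Ioo (0 : ℝ) 1) := by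
    intro u hu x hx
    obtain ⟨s, hs, hus⟩ := hu x hx
    exact ⟨s, hs, A.integrable_comp hus⟩
  refine ⟨hloc f h.1, hloc g h.2, fun φ hφ hc hs => ?_⟩
  have e := congrArg A (h.integral_eq φ hφ hc hs)
  rw [map_neg, ← A.integral_comp_comm (integrable_smul_test h.2 hφ.continuous hc hs),
    ← A.integral_comp_comm (integrable_smul_test h.1 (hφ.continuous_deriv (by simp))
      hc.deriv (tsupport_deriv_subset_of_subset hs))] at e
  simpa using e

theorem add (h : IsWeakDeriv f g) (h₁ : IsWeakDeriv f₁ g₁) :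
    IsWeakDeriv (fun x => f x + f₁ x) (fun x => g x + g₁ x) := by
  refine ⟨h.1.add h₁.1, h.2.add h₁.2, fun φ hφ hc hs => ?_⟩
  simp only [smul_add]
  have hc' := hφ.continuous_deriv (by simp)
  rw [integral_add (integrable_smul_test h.1 hc' hc.deriv (tsupport_deriv_subset_of_subset hs))
      (integrable_smul_test h₁.1 hc' hc.deriv (tsupport_deriv_subset_of_subset hs)),
    integral_add (integrable_smul_test h.2 hφ.continuous hc hs)
      (integrable_smul_test h₁.2 hφ.continuous hc hs),
    h.integral_eq φ hφ hc hs, h₁.integral_eq φ hφ hc hs, neg_add]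

theorem congr (h : IsWeakDeriv f g) (hf : ∀ x ∈ Ioo (0 : ℝ) 1, f x = f₁ x) :
    IsWeakDeriv f₁ g := by
  refine ⟨fun x hx => ?_, h.2, fun φ hφ hc hs => ?_⟩
  · obtain ⟨s, hs, hus⟩ := h.1 x hx
    refine ⟨s ∩ Ioo 0 1, Filter.inter_mem hs self_mem_nhdsWithin, ?_⟩
    have h1 : IntegrableOn f (s ∩ Ioo 0 1) := hus.mono_set inter_subset_left
    refine Integrable.congr h1 ?_
    have := ae_restrict_mem (μ := (volume.restrict s : Measure ℝ))
      (measurableSet_Ioo (a := (0 : ℝ)) (b := 1))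
    rw [Measure.restrict_restrict measurableSet_Ioo, inter_comm] at this
    filter_upwards [this] with y hy using hf y hy
  · rw [← h.integral_eq φ hφ hc hs]
    refine setIntegral_congr_fun measurableSet_Ioo fun x hx => ?_
    simp [hf x hx]

theorem weakDeriv_right (h : IsWeakDeriv f g) : IsWeakDeriv f (weakDeriv f) := by
  have hex : ∃ g : ℝ → F, IsWeakDeriv f g := ⟨g, h⟩
  unfold weakDeriv
  rw [dif_pos hex]
  exact hex.choose_spec

theorem ae_eq [CompleteSpace F] (h : IsWeakDeriv f g) (h₁ : IsWeakDeriv f g₁) :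
    g =ᵐ[volume.restrict (Ioo (0 : ℝ) 1)] g₁ :=
  (weakDeriv_ae_eq h).symm.trans (weakDeriv_ae_eq h₁)

end

theorem coord {f g : ℝ → Plane} (h : IsWeakDeriv f g) (i : Fin 2) :
    IsWeakDeriv (fun x => f x i) (fun x => g x i) :=
  h.clm_comp (EuclideanSpace.proj i)

theorem of_coord {f g : ℝ → Plane} (h : ∀ i, IsWeakDeriv (fun x => f x i) (fun x => g x i)) :
    IsWeakDeriv f g := by
  have := ((h 0).clm_comp (axis 0)).add ((h 1).clm_comp (axis 1))
  simpa only [axis_add] using this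

/-- Integration by parts: the product of `f` and a test function vanishes at both endpoints, so its
derivative has integral zero. -/
theorem of_isPrimitive {f v : ℝ → ℝ} (h : IsPrimitive f v) : IsWeakDeriv f v := by
  have hv : IntegrableOn v (Ioo 0 1) :=
    (intervalIntegrable_iff_integrableOn_Ioo_of_le zero_le_one).1 h.intervalIntegrable
  have hf : LocallyIntegrableOn f (Ioo 0 1) :=
    (h.continuousOn.mono Ioo_subset_Icc_self).locallyIntegrableOn measurableSet_Ioo
  refine ⟨hf, hv.locallyIntegrableOn, fun φ hφ hc hs => ?_⟩
  have hφ1 : ContDiff ℝ 1 φ := hφ.of_le (by simp)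
  have h0 : ∀ x, x ∉ Ioo (0 : ℝ) 1 → φ x = 0 := fun x hx => by
    by_contra h0
    exact hx (hs (subset_tsupport φ h0))
  have hd : IsPrimitive φ (deriv φ) := by
    refine IsPrimitive.of_ae_hasDerivAt (hφ1.contDiffOn.absolutelyContinuousOnInterval)
      ((hφ1.continuous_deriv le_rfl).intervalIntegrable _ _) (.of_forall fun x _ => ?_)
    exact (hφ1.differentiable one_ne_zero x).hasDerivAt
  have e := (hd.mul h).integral_eq_sub
  rw [h0 1 (by simp), h0 0 (by simp), integral_add] at e
  · simp only [smul_eq_mul]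
    rw [show (fun x => deriv φ x * f x) = fun x => f x * deriv φ x by ext; ring]
    linarith
  · have := integrable_smul_test hf (hφ1.continuous_deriv le_rfl)
      hc.deriv (tsupport_deriv_subset_of_subset hs)
    simpa only [mul_comm, smul_eq_mul] using this.integrable
  · exact integrable_smul_test hv.locallyIntegrableOn hφ1.continuous hc hs

/-- The lemma of du Bois-Reymond. -/
theorem exists_ae_eq_const {f : ℝ → ℝ} (h : IsWeakDeriv f 0) :
    ∃ c : ℝ, ∀ᵐ x ∂volume.restrict (Ioo (0 : ℝ) 1), f x = c := by
  obtain ⟨ρ, hρs, hρc, hρ⟩ : ∃ ρ : ContDiffBump (1 / 2 : ℝ),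
      tsupport ρ ⊆ Ioo 0 1 ∧ HasCompactSupport ρ ∧ ContDiff ℝ ∞ ρ := by
    refine ⟨⟨1 / 8, 1 / 4, by norm_num, by norm_num⟩, ?_, ContDiffBump.hasCompactSupport _,
      ContDiffBump.contDiff _⟩
    rw [ContDiffBump.tsupport_eq]
    intro x hx
    rw [Metric.mem_closedBall, Real.dist_eq, abs_le] at hx
    constructor <;> linarith [hx.1, hx.2]
  set J : ℝ := ∫ x, ρ x with hJdef
  have hJ : 0 < J := ρ.integral_pos
  -- Testing against `ρ` shows that the constant can only be the `ρ`-weighted mean of `f`.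
  set c : ℝ := J⁻¹ * ∫ x in Ioo (0 : ℝ) 1, ρ x * f x with hcdef
  have hconst : LocallyIntegrableOn (fun _ : ℝ => c) (Ioo 0 1) :=
    continuousOn_const.locallyIntegrableOn measurableSet_Ioo
  refine ⟨c, ?_⟩
  have key : ∀ᵐ x ∂(volume : Measure ℝ), x ∈ Ioo (0 : ℝ) 1 → (f x - c) = 0 := by
    refine isOpen_Ioo.ae_eq_zero_of_integral_contDiff_smul_eq_zero
      (f := fun x => f x - c) (h.1.sub hconst) ?_
    intro φ hφ hφc hφs
    have hint : ∀ ψ : ℝ → ℝ, tsupport ψ ⊆ Ioo 0 1 →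
        ∫ x in Ioo (0 : ℝ) 1, ψ x = ∫ x, ψ x := fun ψ hψ => by
      refine setIntegral_eq_integral_of_forall_compl_eq_zero fun x hx => ?_
      by_contra h0
      exact hx (hψ (subset_tsupport ψ h0))
    have hφi : Integrable φ := hφ.continuous.integrable_of_hasCompactSupport hφc
    have hρi : Integrable ρ := hρ.continuous.integrable_of_hasCompactSupport hρc
    -- Subtracting `m * ρ` gives `ψ` zero integral, so its primitive `Ψ` has compact support in the
    -- interval and is itself an admissible test function.
    set m : ℝ := J⁻¹ * ∫ x, φ x with hm
    set ψ : ℝ → ℝ := fun x => φ x - m * ρ x with hψdef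
    have hψ : ContDiff ℝ ∞ ψ := hφ.sub (contDiff_const.mul hρ)
    have hψ0 : ∫ x, ψ x = 0 := by
      rw [hψdef, integral_sub hφi (hρi.const_mul m), integral_const_mul, ← hJdef, hm]
      field_simp
      ring
    obtain ⟨K, hK, hKs, hψK⟩ : ∃ K : Set ℝ, IsCompact K ∧ K ⊆ Ioo 0 1 ∧
        ∀ x, x ∉ K → ψ x = 0 := by
      refine ⟨tsupport φ ∪ tsupport ρ, hφc.isCompact.union hρc.isCompact,
        union_subset hφs hρs, fun x hx => ?_⟩
      have h1 : φ x = 0 := image_eq_zero_of_notMem_tsupport fun h => hx (Or.inl h)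
      have h2 : ρ x = 0 := image_eq_zero_of_notMem_tsupport fun h => hx (Or.inr h)
      simp [hψdef, h1, h2]
    set Ψ : ℝ → ℝ := fun x => ∫ t in (0 : ℝ)..x, ψ t with hΨdef
    have hΨd : ∀ x, HasDerivAt Ψ (ψ x) x := fun x =>
      hψ.continuous.integral_hasStrictDerivAt 0 x |>.hasDerivAt
    have hΨderiv : deriv Ψ = ψ := funext fun x => (hΨd x).deriv
    have hΨ : ContDiff ℝ ∞ Ψ := by
      rw [contDiff_infty_iff_deriv]
      exact ⟨fun x => (hΨd x).differentiableAt, by rwa [hΨderiv]⟩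
    obtain ⟨a, b, ha, hab, hb, hKab⟩ : ∃ a b : ℝ, 0 < a ∧ a ≤ b ∧ b < 1 ∧ K ⊆ Icc a b := by
      rcases K.eq_empty_or_nonempty with rfl | hne
      · exact ⟨1 / 2, 1 / 2, by norm_num, le_rfl, by norm_num, empty_subset _⟩
      · have h1 := hK.sInf_mem hne
        have h2 := hK.sSup_mem hne
        exact ⟨sInf K, sSup K, (hKs h1).1, csInf_le hK.bddBelow h2, (hKs h2).2,
          fun x hx => ⟨csInf_le hK.bddBelow hx, le_csSup hK.bddAbove hx⟩⟩
    have hΨa : ∀ x, x < a → Ψ x = 0 := by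
      intro x hx
      rw [hΨdef]
      refine (intervalIntegral.integral_congr (g := fun _ => 0) fun t ht => ?_).trans (by simp)
      refine hψK t fun h => ?_
      have h1 := (hKab h).1
      have := ht.2
      have : t < a := lt_of_le_of_lt ht.2 (max_lt ha hx)
      linarith
    have hΨb : ∀ x, b < x → Ψ x = 0 := by
      intro x hx
      have h1 : Ψ x = ∫ t, ψ t := by
        rw [hΨdef]
        simp only
        rw [intervalIntegral.integral_of_le (by linarith)]
        refine setIntegral_eq_integral_of_forall_compl_eq_zero fun t ht => hψK t fun h => ht ?_
        have := hKab h
        exact ⟨lt_of_lt_of_le ha this.1, this.2.trans hx.le⟩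
      rw [h1, hψ0]
    have hΨt : tsupport Ψ ⊆ Icc a b := by
      refine closure_minimal (fun x hx => ?_) isClosed_Icc
      by_contra hxn
      rw [mem_Icc, not_and_or, not_le, not_le] at hxn
      exact hx (hxn.elim (hΨa x) (hΨb x))
    have hΨs : tsupport Ψ ⊆ Ioo 0 1 := hΨt.trans fun x hx => ⟨ha.trans_le hx.1, hx.2.trans_lt hb⟩
    have e := h.integral_eq Ψ hΨ (HasCompactSupport.of_support_subset_isCompact isCompact_Icc
      ((subset_tsupport _).trans hΨt)) hΨs
    simp only [hΨderiv, smul_eq_mul, Pi.zero_apply, mul_zero, integral_zero, neg_zero] at e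
    have hfφ := integrable_smul_test h.1 hφ.continuous hφc hφs
    have hfρ := integrable_smul_test h.1 hρ.continuous hρc hρs
    simp only [smul_eq_mul] at hfφ hfρ
    have e1 : ∫ x in Ioo (0 : ℝ) 1, ψ x * f x
        = (∫ x in Ioo (0 : ℝ) 1, φ x * f x) - m * ∫ x in Ioo (0 : ℝ) 1, ρ x * f x := by
      rw [← integral_const_mul, ← integral_sub hfφ (hfρ.const_mul m)]
      congr 1
      ext x
      simp only [hψdef]
      ring
    have e2 : ∫ x, φ x • (f x - c) = ∫ x in Ioo (0 : ℝ) 1, φ x • (f x - c) := by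
      refine (setIntegral_eq_integral_of_forall_compl_eq_zero fun x hx => ?_).symm
      rw [image_eq_zero_of_notMem_tsupport fun h => hx (hφs h), zero_smul]
    rw [e2]
    simp only [smul_eq_mul, mul_sub]
    rw [integral_sub hfφ (hφi.integrableOn.mul_const c), integral_mul_const, hint φ hφs]
    rw [e1] at e
    linear_combination e
  filter_upwards [ae_restrict_of_ae key, ae_restrict_mem measurableSet_Ioo] with x hx hxm
  exact sub_eq_zero.1 (hx hxm)

/-- Subtracting the primitive of `g` leaves a function with zero weak derivative, to which du
Bois-Reymond applies. -/
theorem exists_ae_eq_add_integral {f g : ℝ → ℝ} (h : IsWeakDeriv f g)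
    (hg : IntegrableOn g (Ioo (0 : ℝ) 1)) :
    ∃ c : ℝ, ∀ᵐ x ∂volume.restrict (Ioo (0 : ℝ) 1), f x = c + ∫ t in (0 : ℝ)..x, g t := by
  have hp := IsPrimitive.of_integral 0
    ((intervalIntegrable_iff_integrableOn_Ioo_of_le zero_le_one).2 hg)
  have h1 := h.add ((of_isPrimitive hp).clm_comp (-ContinuousLinearMap.id ℝ ℝ))
  have h2 : IsWeakDeriv (fun x => f x - ∫ t in (0 : ℝ)..x, g t) 0 := by
    convert! h1 using 1
    · ext x; simp [sub_eq_add_neg]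
    · ext x; simp
  obtain ⟨c, hc⟩ := h2.exists_ae_eq_const
  refine ⟨c, ?_⟩
  filter_upwards [hc] with x hx
  linarith

/-- A continuous function with an integrable weak derivative is a primitive of it. -/
theorem isPrimitive {f g : ℝ → ℝ} (h : IsWeakDeriv f g) (hg : IntegrableOn g (Ioo (0 : ℝ) 1))
    (hf : ContinuousOn f (Icc 0 1)) : IsPrimitive f g := by
  obtain ⟨c, hc⟩ := h.exists_ae_eq_add_integral hg
  have hp := IsPrimitive.of_integral c
    ((intervalIntegrable_iff_integrableOn_Ioo_of_le zero_le_one).2 hg)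
  have hc' : ∀ᵐ x ∂volume.restrict (Icc (0 : ℝ) 1), f x = c + ∫ t in (0 : ℝ)..x, g t := by
    rwa [restrict_Ioo_eq_restrict_Icc] at hc
  exact hp.congr_left fun x hx =>
    (Measure.eqOn_Icc_of_ae_eq volume zero_ne_one hc' hf hp.continuousOn hx).symm

end IsWeakDeriv
-- Square integrability and the lifting of angles
theorem memLp_continuousOn_mul {f v : ℝ → ℝ} (hf : ContinuousOn f (Icc 0 1))
    (hv : MemLp v 2 (volume.restrict (Ioo (0 : ℝ) 1))) :
    MemLp (fun x => f x * v x) 2 (volume.restrict (Ioo (0 : ℝ) 1)) := by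
  obtain ⟨M, hM⟩ := isCompact_Icc.exists_bound_of_continuousOn hf
  refine hv.of_le_mul (c := M) (((hf.mono Ioo_subset_Icc_self).aestronglyMeasurable
    measurableSet_Ioo).mul hv.aestronglyMeasurable) ?_
  filter_upwards [ae_restrict_mem measurableSet_Ioo] with x hx
  rw [norm_mul]
  exact mul_le_mul_of_nonneg_right (hM x (Ioo_subset_Icc_self hx)) (norm_nonneg _)

theorem memLp_of_continuousOn {f : ℝ → ℝ} (hf : ContinuousOn f (Icc 0 1)) :
    MemLp f 2 (volume.restrict (Ioo (0 : ℝ) 1)) := by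
  simpa using memLp_continuousOn_mul hf (memLp_const (1 : ℝ))

theorem intervalIntegrable_of_memLp {v : ℝ → ℝ}
    (hv : MemLp v 2 (volume.restrict (Ioo (0 : ℝ) 1))) : IntervalIntegrable v volume 0 1 :=
  (intervalIntegrable_iff_integrableOn_Ioo_of_le zero_le_one).2 (hv.integrable one_le_two)

theorem MemH1.of_isPrimitive {f v : ℝ → ℝ} (h : IsPrimitive f v)
    (hv : MemLp v 2 (volume.restrict (Ioo (0 : ℝ) 1))) : MemH1 f :=
  ⟨memLp_of_continuousOn h.continuousOn, v, .of_isPrimitive h, hv⟩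

theorem MemH1.weakDeriv {f : ℝ → ℝ} (h : MemH1 f) :
    IsWeakDeriv f (weakDeriv f) ∧ MemLp (weakDeriv f) 2 (volume.restrict (Ioo (0 : ℝ) 1)) := by
  obtain ⟨-, g, hg, hg2⟩ := h
  exact ⟨hg.weakDeriv_right, hg2.ae_eq (weakDeriv_ae_eq hg).symm⟩

/-- Polar coordinates with absolutely continuous angle along a curve avoiding the origin. -/
theorem exists_angle {a b a' b' : ℝ → ℝ} (ha : IsPrimitive a a') (hb : IsPrimitive b b')
    (ha' : MemLp a' 2 (volume.restrict (Ioo (0 : ℝ) 1)))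
    (hb' : MemLp b' 2 (volume.restrict (Ioo (0 : ℝ) 1)))
    (hpos : ∀ x ∈ Icc (0 : ℝ) 1, 0 < a x ^ 2 + b x ^ 2) :
    ∃ θ v : ℝ → ℝ, IsPrimitive θ v ∧ MemLp v 2 (volume.restrict (Ioo (0 : ℝ) 1)) ∧
      ∀ x ∈ Icc (0 : ℝ) 1, a x = √(a x ^ 2 + b x ^ 2) * Real.cos (θ x) ∧
        b x = √(a x ^ 2 + b x ^ 2) * Real.sin (θ x) := by
  have hac := ha.continuousOn
  have hbc := hb.continuousOn
  have hD : ContinuousOn (fun x => (a x ^ 2 + b x ^ 2)⁻¹) (Icc 0 1) :=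
    ((hac.pow 2).add (hbc.pow 2)).inv₀ fun x hx => (hpos x hx).ne'
  have haD := hD.mul hac
  have hbD := hD.mul hbc
  -- `p` and `q` are the real and imaginary parts of `(a' + i b') / (a + i b)`, the derivatives of
  -- the logarithm of the modulus and of the argument.
  set p : ℝ → ℝ := fun x => (a x ^ 2 + b x ^ 2)⁻¹ * a x * a' x
    + (a x ^ 2 + b x ^ 2)⁻¹ * b x * b' x with hp
  set q : ℝ → ℝ := fun x => (a x ^ 2 + b x ^ 2)⁻¹ * a x * b' x
    - (a x ^ 2 + b x ^ 2)⁻¹ * b x * a' x with hq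
  have hp2 : MemLp p 2 (volume.restrict (Ioo (0 : ℝ) 1)) :=
    (memLp_continuousOn_mul haD ha').add (memLp_continuousOn_mul hbD hb')
  have hq2 : MemLp q 2 (volume.restrict (Ioo (0 : ℝ) 1)) :=
    (memLp_continuousOn_mul haD hb').sub (memLp_continuousOn_mul hbD ha')
  set θ₀ : ℝ := Complex.arg ⟨a 0, b 0⟩
  set R : ℝ := ‖(⟨a 0, b 0⟩ : ℂ)‖ with hR
  have hRpos : 0 < R := by
    rw [hR, norm_pos_iff]
    intro h0
    have h1 := congrArg Complex.re h0
    have h2 := congrArg Complex.im h0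
    have := hpos 0 (by simp)
    simp only [Complex.zero_re, Complex.zero_im] at h1 h2
    rw [h1, h2] at this
    simp at this
  have hac0 : a 0 = R * Real.cos θ₀ := (Complex.norm_mul_cos_arg ⟨a 0, b 0⟩).symm
  have hbs0 : b 0 = R * Real.sin θ₀ := (Complex.norm_mul_sin_arg ⟨a 0, b 0⟩).symm
  have hθ := IsPrimitive.of_integral θ₀ (intervalIntegrable_of_memLp hq2)
  have hl := IsPrimitive.of_integral 0 (intervalIntegrable_of_memLp hp2)
  have hθ0 : θ₀ + ∫ t in (0 : ℝ)..0, q t = θ₀ := by simp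
  have hl0 : (0 : ℝ) + ∫ t in (0 : ℝ)..0, p t = 0 := by simp
  set θ : ℝ → ℝ := fun x => θ₀ + ∫ t in (0 : ℝ)..x, q t
  set l : ℝ → ℝ := fun x => 0 + ∫ t in (0 : ℝ)..x, p t
  have hcos := hθ.comp Real.hasDerivAt_cos (by fun_prop)
  have hsin := hθ.comp Real.hasDerivAt_sin (by fun_prop)
  have hnsin := hθ.comp (Φ := fun x => -Real.sin x)
    (fun x => (Real.hasDerivAt_sin x).neg) (by fun_prop)
  have hexp := hl.comp (Φ := fun x => Real.exp (-x)) (Φ' := fun x => - Real.exp (-x))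
    (fun x => by simpa using (hasDerivAt_neg x).exp) (by fun_prop)
  refine ⟨θ, q, hθ, hq2, fun x hx => ?_⟩
  -- With `l` and `θ` the primitives of `p` and `q`, the product `(a + i b) exp(-l - i θ)` has zero
  -- derivative. `hX` and `hY` state that its real and imaginary parts are constant.
  have hX := (((ha.mul hcos).add (hb.mul hsin)).mul hexp).eq_of_zero (fun x hx => by
    have := (hpos x hx).ne'
    simp only [hp, hq]
    field_simp
    ring) x hx
  have hY := (((hb.mul hcos).add (ha.mul hnsin)).mul hexp).eq_of_zero (fun x hx => by
    have := (hpos x hx).ne'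
    simp only [hp, hq]
    field_simp
    ring) x hx
  simp only [show θ 0 = θ₀ from hθ0, show l 0 = 0 from hl0, neg_zero, Real.exp_zero,
    mul_one] at hX hY
  rw [hac0, hbs0] at hX hY
  have hE : Real.exp (-l x) * Real.exp (l x) = 1 := by rw [← Real.exp_add]; simp
  have hX' : a x * Real.cos (θ x) + b x * Real.sin (θ x) = R * Real.exp (l x) := by
    linear_combination Real.exp (l x) * hX
      - (a x * Real.cos (θ x) + b x * Real.sin (θ x)) * hE
      + R * Real.exp (l x) * Real.sin_sq_add_cos_sq θ₀
  have hY' : b x * Real.cos (θ x) - a x * Real.sin (θ x) = 0 := by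
    linear_combination Real.exp (l x) * hY
      - (b x * Real.cos (θ x) - a x * Real.sin (θ x)) * hE
  have h1 : a x = R * Real.exp (l x) * Real.cos (θ x) := by
    linear_combination Real.cos (θ x) * hX' - Real.sin (θ x) * hY'
      - a x * Real.sin_sq_add_cos_sq (θ x)
  have h2 : b x = R * Real.exp (l x) * Real.sin (θ x) := by
    linear_combination Real.sin (θ x) * hX' + Real.cos (θ x) * hY'
      - b x * Real.sin_sq_add_cos_sq (θ x)
  have h3 : √(a x ^ 2 + b x ^ 2) = R * Real.exp (l x) := by
    rw [Real.sqrt_eq_iff_mul_self_eq (by positivity) (by positivity)]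
    linear_combination (a x + R * Real.exp (l x) * Real.cos (θ x)) * h1
      + (b x + R * Real.exp (l x) * Real.sin (θ x)) * h2
      + (R * Real.exp (l x)) ^ 2 * Real.sin_sq_add_cos_sq (θ x)
  rw [h3]
  exact ⟨h1, h2⟩

/-! ### Curvature and energy in terms of the tangential angle -/

theorem norm_plane (z : Plane) : ‖z‖ = √(z 0 ^ 2 + z 1 ^ 2) := by
  simp [EuclideanSpace.norm_eq]

section Curves

variable {γ : ℝ → Plane}

theorem velocity_coord (h : ContDiffOn ℝ 1 γ (Icc (0 : ℝ) 1)) (i : Fin 2) {x : ℝ}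
    (hx : x ∈ Icc (0 : ℝ) 1) :
    derivWithin (fun x => γ x i) (Icc (0 : ℝ) 1) x = velocity γ x i := by
  have h1 := ((h.differentiableOn one_ne_zero) x hx).hasDerivWithinAt
  have h2 := (EuclideanSpace.proj (𝕜 := ℝ) i : Plane →L[ℝ] ℝ).hasFDerivAt.comp_hasDerivWithinAt
    x h1
  exact h2.derivWithin (uniqueDiffOn_Icc zero_lt_one x hx)

theorem isPrimitive_coord (h : ContDiffOn ℝ 1 γ (Icc (0 : ℝ) 1)) (i : Fin 2) :
    IsPrimitive (fun x => γ x i) (fun x => velocity γ x i) := by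
  refine (IsPrimitive.of_contDiffOn ?_).congr_right fun x hx => velocity_coord h i hx
  exact (EuclideanSpace.proj (𝕜 := ℝ) i : Plane →L[ℝ] ℝ).contDiff.comp_contDiffOn h

theorem continuousOn_velocity (h : ContDiffOn ℝ 1 γ (Icc (0 : ℝ) 1)) :
    ContinuousOn (velocity γ) (Icc 0 1) :=
  h.continuousOn_derivWithin (uniqueDiffOn_Icc zero_lt_one) le_rfl

theorem continuousOn_coord {f : ℝ → Plane} {s : Set ℝ} (hf : ContinuousOn f s) (i : Fin 2) :
    ContinuousOn (fun x => f x i) s :=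
  (EuclideanSpace.proj (𝕜 := ℝ) i : Plane →L[ℝ] ℝ).continuous.comp_continuousOn hf

/-- The weak derivative supplied by `MemH2` agrees almost everywhere both with the classical
velocity and with a primitive of the second weak derivative. The last two are continuous, so they
agree on all of `[0, 1]`. -/
theorem exists_velocity_primitive (h : γ ∈ H2Imm) (i : Fin 2) :
    ∃ w : ℝ → ℝ, IsPrimitive (fun x => velocity γ x i) w ∧
      MemLp w 2 (volume.restrict (Ioo (0 : ℝ) 1)) := by
  obtain ⟨⟨-, g, hg, -, w, hw, hw2⟩, hC, -⟩ := h
  have hp := isPrimitive_coord hC i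
  have hae := (hg.coord i).ae_eq (.of_isPrimitive hp)
  have hwi := memLp_coord hw2 i
  obtain ⟨c, hc⟩ := (hw.coord i).exists_ae_eq_add_integral (hwi.integrable one_le_two)
  have hP := IsPrimitive.of_integral c (intervalIntegrable_of_memLp hwi)
  refine ⟨fun x => w x i, hP.congr_left ?_, hwi⟩
  have hc' : ∀ᵐ x ∂volume.restrict (Icc (0 : ℝ) 1),
      c + ∫ t in (0 : ℝ)..x, w t i = velocity γ x i := by
    rw [← restrict_Ioo_eq_restrict_Icc]
    filter_upwards [hae, hc] with x h1 h2
    rw [← h2, h1]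
  exact fun x hx => Measure.eqOn_Icc_of_ae_eq volume zero_ne_one hc' hP.continuousOn
    (continuousOn_coord (continuousOn_velocity hC) i) hx

theorem norm_velocity_pos (h : γ ∈ H2Imm) {x : ℝ} (hx : x ∈ Icc (0 : ℝ) 1) :
    0 < ‖velocity γ x‖ := by
  obtain ⟨-, -, c, hc, hle⟩ := h
  exact hc.trans_le (hle x hx)

theorem exists_isTangentialAngle (h : γ ∈ H2Imm) : ∃ θ, IsTangentialAngle γ θ := by
  obtain ⟨a', ha, ha'⟩ := exists_velocity_primitive h 0
  obtain ⟨b', hb, hb'⟩ := exists_velocity_primitive h 1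
  obtain ⟨θ, v, hθ, hv, hangle⟩ := exists_angle ha hb ha' hb' (fun x hx => by
    have := norm_velocity_pos h hx
    rw [norm_plane] at this
    exact Real.sqrt_pos.1 this)
  refine ⟨θ, .of_isPrimitive hθ hv, hθ.continuousOn, fun x hx => ?_⟩
  have hpos := norm_velocity_pos h hx
  obtain ⟨h1, h2⟩ := hangle x hx
  rw [← norm_plane] at h1 h2
  ext i
  fin_cases i
  · simp only [unitTangent, PiLp.smul_apply, smul_eq_mul]
    simp
    rw [h1]
    field_simp
  · simp only [unitTangent, PiLp.smul_apply, smul_eq_mul]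
    simp
    rw [h2]
    field_simp

theorem isTangentialAngle_tangentialAngle (h : γ ∈ H2Imm) :
    IsTangentialAngle γ (tangentialAngle γ) := by
  have hex := exists_isTangentialAngle h
  unfold tangentialAngle
  rw [dif_pos hex]
  exact hex.choose_spec

namespace IsTangentialAngle

variable {θ θ₁ : ℝ → ℝ}

theorem isPrimitive (h : IsTangentialAngle γ θ) : IsPrimitive θ (weakDeriv θ) :=
  h.1.weakDeriv.1.isPrimitive (h.1.weakDeriv.2.integrable one_le_two) h.2.1

theorem isWeakDeriv_unitTangent (h : IsTangentialAngle γ θ) :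
    IsWeakDeriv (unitTangent γ)
      (fun x => weakDeriv θ x • !₂[-Real.sin (θ x), Real.cos (θ x)]) := by
  have hcos := IsWeakDeriv.of_isPrimitive (h.isPrimitive.comp Real.hasDerivAt_cos (by fun_prop))
  have hsin := IsWeakDeriv.of_isPrimitive (h.isPrimitive.comp Real.hasDerivAt_sin (by fun_prop))
  have : IsWeakDeriv (fun x => (!₂[Real.cos (θ x), Real.sin (θ x)] : Plane))
      (fun x => weakDeriv θ x • !₂[-Real.sin (θ x), Real.cos (θ x)]) := by
    refine IsWeakDeriv.of_coord fun i => ?_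
    fin_cases i
    · simpa [mul_comm] using hcos
    · simpa [mul_comm] using hsin
  exact this.congr fun x hx => (h.2.2 x (Ioo_subset_Icc_self hx)).symm

theorem weakDeriv_unitTangent (h : IsTangentialAngle γ θ) :
    ∀ᵐ x ∂volume.restrict (Ioo (0 : ℝ) 1), weakDeriv (unitTangent γ) x
      = weakDeriv θ x • !₂[-Real.sin (θ x), Real.cos (θ x)] :=
  weakDeriv_ae_eq h.isWeakDeriv_unitTangent

/-- Both derivatives are the normal component of the weak derivative of the unit tangent. Hence the
total curvature does not depend on the angle chosen, and uniqueness modulo `2π` is not needed. -/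
theorem weakDeriv_ae_eq_weakDeriv (h : IsTangentialAngle γ θ) (h₁ : IsTangentialAngle γ θ₁) :
    ∀ᵐ x ∂volume.restrict (Ioo (0 : ℝ) 1), weakDeriv θ x = weakDeriv θ₁ x := by
  filter_upwards [h.weakDeriv_unitTangent, h₁.weakDeriv_unitTangent,
    ae_restrict_mem measurableSet_Ioo] with x e e₁ hx
  have ht := (h.2.2 x (Ioo_subset_Icc_self hx)).symm.trans (h₁.2.2 x (Ioo_subset_Icc_self hx))
  have hc := congrArg (fun z : Plane => z 0) ht
  have hs := congrArg (fun z : Plane => z 1) ht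
  have e' := e.symm.trans e₁
  have e0 := congrArg (fun z : Plane => z 0) e'
  have e1 := congrArg (fun z : Plane => z 1) e'
  simp at hc hs e0 e1
  rw [← hs] at e0
  rw [← hc] at e1
  linear_combination Real.sin (θ x) * e0 + Real.cos (θ x) * e1
    - (weakDeriv θ x - weakDeriv θ₁ x) * Real.sin_sq_add_cos_sq (θ x)

theorem totalCurvature_eq (h : IsTangentialAngle γ θ) (hγ : γ ∈ H2Imm) :
    totalCurvature γ = ∫ x in Ioo (0 : ℝ) 1, weakDeriv θ x := by
  refine integral_congr_ae ?_
  filter_upwards [(isTangentialAngle_tangentialAngle hγ).weakDeriv_ae_eq_weakDeriv h,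
    ae_restrict_mem measurableSet_Ioo] with x e hx
  have := norm_velocity_pos hγ (Ioo_subset_Icc_self hx)
  rw [signedCurvature, e]
  field_simp

theorem bendingEnergy_eq (h : IsTangentialAngle γ θ) (hγ : γ ∈ H2Imm) :
    bendingEnergy γ = ∫ x in Ioo (0 : ℝ) 1, weakDeriv θ x ^ 2 / ‖velocity γ x‖ := by
  refine integral_congr_ae ?_
  filter_upwards [h.weakDeriv_unitTangent, ae_restrict_mem measurableSet_Ioo] with x e hx
  have := norm_velocity_pos hγ (Ioo_subset_Icc_self hx)
  have hn : ‖(!₂[-Real.sin (θ x), Real.cos (θ x)] : Plane)‖ = 1 := by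
    rw [norm_plane]
    simp
  rw [curvatureVector, e, norm_smul, norm_smul, hn, norm_inv, norm_norm, mul_one, mul_pow,
    Real.norm_eq_abs, sq_abs]
  field_simp

theorem velocity_eq (h : IsTangentialAngle γ θ) {x : ℝ} (hx : x ∈ Icc (0 : ℝ) 1) :
    velocity γ x = ‖velocity γ x‖ • !₂[Real.cos (θ x), Real.sin (θ x)] := by
  rw [← h.2.2 x hx, unitTangent, smul_smul]
  rcases eq_or_ne ‖velocity γ x‖ 0 with h0 | h0
  · rw [norm_eq_zero.1 h0]
    simp
  · rw [mul_inv_cancel₀ h0, one_smul]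

end IsTangentialAngle
end Curves
-- Weak compactness and the reduced problem
open Filter Topology

open Filter Topology

/-- Sequential Banach–Alaoglu for the dual of a separable space, carried over to `H` by the Riesz
isomorphism. -/
theorem exists_weakly_convergent_subseq {H : Type*} [NormedAddCommGroup H] [InnerProductSpace ℝ H]
    [CompleteSpace H] [TopologicalSpace.SeparableSpace H] {f : ℕ → H} {M : ℝ}
    (hf : ∀ n, ‖f n‖ ≤ M) :
    ∃ g : H, ∃ φ : ℕ → ℕ, StrictMono φ ∧
      ∀ w : H, Tendsto (fun n => inner ℝ (f (φ n)) w) atTop (𝓝 (inner ℝ g w)) := by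
  obtain ⟨G, -, φ, hφ, hG⟩ := WeakDual.isSeqCompact_closedBall ℝ H 0 M
    (x := fun n => StrongDual.toWeakDual (InnerProductSpace.toDual ℝ H (f n))) (fun n => by
      simp only [mem_preimage, mem_closedBall_zero_iff]
      exact ((InnerProductSpace.toDual ℝ H).norm_map (f n)).trans_le (hf n))
  refine ⟨(InnerProductSpace.toDual ℝ H).symm (WeakDual.toStrongDual G), φ, hφ, fun w => ?_⟩
  rw [InnerProductSpace.toDual_symm_apply]
  exact ((WeakDual.eval_continuous w).tendsto G).comp hG

/-- The angle function on `[0, 1]` with derivative `v` which vanishes at `0`. -/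
noncomputable def turning (v : ℝ → ℝ) (x : ℝ) : ℝ := ∫ t in (0 : ℝ)..x, v t

/-- `v` is the derivative of the tangential angle of an arc of length `L` parametrised by `[0, 1]`
proportionally to arclength, with total curvature `r` and with endpoints at distance `|ℓ|`. -/
structure IsFeasible (ℓ r L : ℝ) (v : ℝ → ℝ) : Prop where
  pos : 0 < L
  memLp : MemLp v 2 (volume.restrict (Ioo (0 : ℝ) 1))
  integral_eq : ∫ x in Ioo (0 : ℝ) 1, v x = r
  chord : L ^ 2 * ((∫ x in Ioo (0 : ℝ) 1, Real.cos (turning v x)) ^ 2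
    + (∫ x in Ioo (0 : ℝ) 1, Real.sin (turning v x)) ^ 2) = ℓ ^ 2

/-- The energy of an arc of length `L` whose tangential angle has the derivative `v` with respect
to the parameter proportional to arclength. -/
noncomputable def arcEnergy (L : ℝ) (v : ℝ → ℝ) : ℝ :=
  (∫ x in Ioo (0 : ℝ) 1, v x ^ 2) / L + L

theorem integrableOn_of_continuousOn {f : ℝ → ℝ} (hf : ContinuousOn f (Icc 0 1)) :
    IntegrableOn f (Ioo 0 1) :=
  hf.integrableOn_Icc.mono_set Ioo_subset_Icc_self

/-- The two angles differ by the constant `θ 0`, so the chord vectors differ by a rotation and have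
the same norm. -/
theorem sq_add_sq_turning {θ v : ℝ → ℝ} (h : IsPrimitive θ v) :
    (∫ x in Ioo (0 : ℝ) 1, Real.cos (turning v x)) ^ 2
      + (∫ x in Ioo (0 : ℝ) 1, Real.sin (turning v x)) ^ 2
    = (∫ x in Ioo (0 : ℝ) 1, Real.cos (θ x)) ^ 2 + (∫ x in Ioo (0 : ℝ) 1, Real.sin (θ x)) ^ 2 := by
  have hc : IntegrableOn (fun x => Real.cos (θ x)) (Ioo 0 1) :=
    integrableOn_of_continuousOn (Real.continuous_cos.comp_continuousOn h.continuousOn)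
  have hs : IntegrableOn (fun x => Real.sin (θ x)) (Ioo 0 1) :=
    integrableOn_of_continuousOn (Real.continuous_sin.comp_continuousOn h.continuousOn)
  have ht : ∀ x ∈ Ioo (0 : ℝ) 1, turning v x = θ x - θ 0 := fun x hx => by
    rw [h.eq_add_integral x (Ioo_subset_Icc_self hx), turning]
    ring
  have e1 : ∫ x in Ioo (0 : ℝ) 1, Real.cos (turning v x)
      = Real.cos (θ 0) * (∫ x in Ioo (0 : ℝ) 1, Real.cos (θ x))
        + Real.sin (θ 0) * ∫ x in Ioo (0 : ℝ) 1, Real.sin (θ x) := by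
    rw [← integral_const_mul, ← integral_const_mul,
      ← integral_add (hc.const_mul _) (hs.const_mul _)]
    refine setIntegral_congr_fun measurableSet_Ioo fun x hx => ?_
    simp only [ht x hx, Real.cos_sub]
    ring
  have e2 : ∫ x in Ioo (0 : ℝ) 1, Real.sin (turning v x)
      = Real.cos (θ 0) * (∫ x in Ioo (0 : ℝ) 1, Real.sin (θ x))
        - Real.sin (θ 0) * ∫ x in Ioo (0 : ℝ) 1, Real.cos (θ x) := by
    rw [← integral_const_mul, ← integral_const_mul,
      ← integral_sub (hs.const_mul _) (hc.const_mul _)]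
    refine setIntegral_congr_fun measurableSet_Ioo fun x hx => ?_
    simp only [ht x hx, Real.sin_sub]
    ring
  rw [e1, e2]
  linear_combination ((∫ x in Ioo (0 : ℝ) 1, Real.cos (θ x)) ^ 2
    + (∫ x in Ioo (0 : ℝ) 1, Real.sin (θ x)) ^ 2) * Real.sin_sq_add_cos_sq (θ 0)

/-! ### Lower bounds for the length -/

theorem continuousOn_turning {v : ℝ → ℝ} (hv : MemLp v 2 (volume.restrict (Ioo (0 : ℝ) 1))) :
    ContinuousOn (turning v) (Icc 0 1) := by
  have := (IsPrimitive.of_integral 0 (intervalIntegrable_of_memLp hv)).continuousOn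
  simp only [zero_add] at this
  exact this

/-- The tangential angle of a closed arc of length one has a derivative of norm more than one. -/
theorem one_lt_integral_sq {v : ℝ → ℝ} (hv : MemLp v 2 (volume.restrict (Ioo (0 : ℝ) 1)))
    (h0 : ∫ x in Ioo (0 : ℝ) 1, Real.cos (turning v x) = 0) :
    1 < ∫ x in Ioo (0 : ℝ) 1, v x ^ 2 := by
  by_contra! hle
  have hvi : IntegrableOn v (Ioo 0 1) := hv.integrable one_le_two
  have hsq : IntegrableOn (fun x => v x ^ 2) (Ioo 0 1) := hv.integrable_sq
  have hone : IntegrableOn (fun _ : ℝ => (1 : ℝ)) (Ioo 0 1) := integrable_const _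
  -- The inequality `2|v| ≤ v² + 1` bounds the total variation of the angle by 1.
  have habs : ∫ x in Ioo (0 : ℝ) 1, |v x| ≤ 1 := by
    calc ∫ x in Ioo (0 : ℝ) 1, |v x| ≤ ∫ x in Ioo (0 : ℝ) 1, (v x ^ 2 + 1) / 2 := by
          refine integral_mono hvi.abs ((hsq.add hone).div_const 2) fun x => ?_
          simp only
          nlinarith [sq_nonneg (|v x| - 1), sq_abs (v x)]
      _ = ((∫ x in Ioo (0 : ℝ) 1, v x ^ 2) + 1) / 2 := by
          rw [integral_div, integral_add hsq hone]
          simp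
      _ ≤ 1 := by linarith
  have hturn : ∀ x ∈ Ioo (0 : ℝ) 1, |turning v x| ≤ 1 := by
    intro x hx
    rw [turning, intervalIntegral.integral_of_le hx.1.le, integral_Ioc_eq_integral_Ioo]
    refine (abs_integral_le_integral_abs).trans (le_trans ?_ habs)
    exact setIntegral_mono_set hvi.abs (.of_forall fun x => abs_nonneg _)
      (Ioo_subset_Ioo_right hx.2.le).eventuallyLE
  -- As the angle stays in `[-1, 1]`, the bound `cos y ≥ 1 - y² / 2` keeps the cosine at least `1 /
  -- 2`, contradicting `h0`.
  have hcos : ∫ x in Ioo (0 : ℝ) 1, (1 / 2 : ℝ) ≤ ∫ x in Ioo (0 : ℝ) 1, Real.cos (turning v x) := by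
    refine setIntegral_mono_on (integrable_const _) (integrableOn_of_continuousOn
      (Real.continuous_cos.comp_continuousOn (continuousOn_turning hv))) measurableSet_Ioo
      fun x hx => ?_
    have h1 := Real.one_sub_sq_div_two_le_cos (x := turning v x)
    have h2 : turning v x ^ 2 ≤ 1 := (sq_le_one_iff_abs_le_one _).2 (hturn x hx)
    linarith
  rw [h0] at hcos
  norm_num at hcos

/-- By Jensen's inequality the squared means of cosine and sine are at most the means of their
squares, which add up to 1. Thus the chord is no longer than the arc. -/
theorem IsFeasible.le_length {ℓ r L : ℝ} {v : ℝ → ℝ} (h : IsFeasible ℓ r L v) (hℓ : 0 ≤ ℓ) :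
    ℓ ≤ L := by
  have hb : ∀ f : ℝ → ℝ, ContinuousOn f (Icc 0 1) → (∫ x in Ioo (0 : ℝ) 1, f x) ^ 2
      ≤ ∫ x in Ioo (0 : ℝ) 1, f x ^ 2 := by
    intro f hf
    have h1 := integrableOn_of_continuousOn hf
    have h2 : IntegrableOn (fun x => f x ^ 2) (Ioo 0 1) :=
      integrableOn_of_continuousOn (hf.pow 2)
    set c := ∫ x in Ioo (0 : ℝ) 1, f x with hc
    have h3 : 0 ≤ ∫ x in Ioo (0 : ℝ) 1, (f x - c) ^ 2 := integral_nonneg fun x => sq_nonneg _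
    have h4 : ∫ x in Ioo (0 : ℝ) 1, (f x - c) ^ 2
        = (∫ x in Ioo (0 : ℝ) 1, f x ^ 2) - 2 * c * c + c ^ 2 := by
      have : ∀ x, (f x - c) ^ 2 = f x ^ 2 - 2 * c * f x + c ^ 2 := fun x => by ring
      simp only [this]
      have h5 : IntegrableOn (fun x => f x ^ 2 - 2 * c * f x) (Ioo 0 1) :=
        h2.sub (h1.const_mul _)
      rw [integral_add h5 (integrable_const _),
        integral_sub h2 (h1.const_mul _), integral_const_mul, ← hc]
      simp
    nlinarith
  have ht := continuousOn_turning h.memLp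
  have hc : ContinuousOn (fun x => Real.cos (turning v x)) (Icc 0 1) :=
    Real.continuous_cos.comp_continuousOn ht
  have hs : ContinuousOn (fun x => Real.sin (turning v x)) (Icc 0 1) :=
    Real.continuous_sin.comp_continuousOn ht
  have h1 := hb _ hc
  have h2 := hb _ hs
  have h3 : (∫ x in Ioo (0 : ℝ) 1, Real.cos (turning v x) ^ 2)
      + (∫ x in Ioo (0 : ℝ) 1, Real.sin (turning v x) ^ 2) = 1 := by
    have hc2 : IntegrableOn (fun x => Real.cos (turning v x) ^ 2) (Ioo 0 1) :=
      integrableOn_of_continuousOn (hc.pow 2)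
    have hs2 : IntegrableOn (fun x => Real.sin (turning v x) ^ 2) (Ioo 0 1) :=
      integrableOn_of_continuousOn (hs.pow 2)
    rw [← integral_add hc2 hs2]
    simp
  have h4 := h.chord
  refine (sq_le_sq₀ hℓ h.pos.le).1 ?_
  rw [← h4]
  exact mul_le_of_le_one_right (sq_nonneg L) (by linarith)

/-- For `ℓ = 0` the chord bound is void; here the bending term alone penalises short arcs. -/
theorem IsFeasible.inv_le_arcEnergy {r L : ℝ} {v : ℝ → ℝ} (h : IsFeasible 0 r L v) :
    L⁻¹ ≤ arcEnergy L v := by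
  have h1 := h.chord
  have hL := h.pos
  have h2 : (∫ x in Ioo (0 : ℝ) 1, Real.cos (turning v x)) = 0 := by
    have h3 := (mul_eq_zero.1 (h1.trans (by norm_num))).resolve_left (by positivity)
    nlinarith [sq_nonneg (∫ x in Ioo (0 : ℝ) 1, Real.sin (turning v x)),
      sq_nonneg (∫ x in Ioo (0 : ℝ) 1, Real.cos (turning v x))]
  have h3 := one_lt_integral_sq h.memLp h2
  rw [arcEnergy, inv_eq_one_div]
  have : 1 / L ≤ (∫ x in Ioo (0 : ℝ) 1, v x ^ 2) / L := by gcongr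
  linarith

/-! ### The reduced problem on `L²` classes -/

/-- The angle at a fixed point is a continuous linear functional of `v`, so weak convergence of
derivatives yields pointwise convergence of angles. -/
theorem turning_eq_inner (f : Lp ℝ 2 (volume.restrict (Ioo (0 : ℝ) 1))) {x : ℝ}
    (hx : x ∈ Icc (0 : ℝ) 1) :
    turning f x = inner ℝ f (indicatorConstLp 2 (measurableSet_Ioo (a := 0) (b := x))
      (measure_ne_top _ _) (1 : ℝ)) := by
  rw [real_inner_comm, L2.inner_indicatorConstLp_one, Measure.restrict_restrict measurableSet_Ioo,
    inter_eq_self_of_subset_left (Ioo_subset_Ioo_right hx.2), turning,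
    intervalIntegral.integral_of_le hx.1, integral_Ioc_eq_integral_Ioo]

theorem integral_sq_eq_norm_sq (f : Lp ℝ 2 (volume.restrict (Ioo (0 : ℝ) 1))) :
    ∫ x in Ioo (0 : ℝ) 1, f x ^ 2 = ‖f‖ ^ 2 := by
  rw [← real_inner_self_eq_norm_sq, L2.inner_def]
  simp [pow_two]

theorem turning_congr_ae {u v : ℝ → ℝ} (h : u =ᵐ[volume.restrict (Ioo (0 : ℝ) 1)] v) {x : ℝ}
    (hx : x ∈ Icc (0 : ℝ) 1) : turning u x = turning v x := by
  rw [turning, turning, intervalIntegral.integral_of_le hx.1, intervalIntegral.integral_of_le hx.1,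
    integral_Ioc_eq_integral_Ioo, integral_Ioc_eq_integral_Ioo]
  exact integral_congr_ae (ae_restrict_of_ae_restrict_of_subset (Ioo_subset_Ioo_right hx.2) h)

theorem IsFeasible.congr_ae {ℓ r L : ℝ} {u v : ℝ → ℝ} (hu : IsFeasible ℓ r L u)
    (h : u =ᵐ[volume.restrict (Ioo (0 : ℝ) 1)] v) : IsFeasible ℓ r L v := by
  refine ⟨hu.pos, hu.memLp.ae_eq h, (integral_congr_ae h).symm.trans hu.integral_eq, ?_⟩
  rw [← hu.chord]
  congr 3
  all_goals
    refine setIntegral_congr_fun measurableSet_Ioo fun x hx => ?_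
    simp only [turning_congr_ae h (Ioo_subset_Icc_self hx)]

theorem arcEnergy_congr_ae {L : ℝ} {u v : ℝ → ℝ}
    (h : u =ᵐ[volume.restrict (Ioo (0 : ℝ) 1)] v) : arcEnergy L u = arcEnergy L v := by
  rw [arcEnergy, arcEnergy]
  congr 2
  refine integral_congr_ae ?_
  filter_upwards [h] with x hx
  rw [hx]

/-! ### Existence of feasible arcs -/

/-- A family of smooth angle functions, odd about `1 / 2`, with total increment `r` on `[0, 1]`
for `0 ≤ a ≤ 3 / 8`. -/
noncomputable def oddAngle (r a x : ℝ) : ℝ :=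
  Real.pi * (Real.smoothTransition (8 * (x - 1 / 2 - a))
      - Real.smoothTransition (8 * (1 / 2 - x - a)))
    + (r / 2 - Real.pi) * (Real.smoothTransition (8 * (x - 7 / 8))
      - Real.smoothTransition (8 * (1 / 8 - x)))

theorem contDiff_oddAngle (r a : ℝ) : ContDiff ℝ 1 (oddAngle r a) := by
  have h : ContDiff ℝ 1 Real.smoothTransition := Real.smoothTransition.contDiff
  unfold oddAngle
  refine (contDiff_const.mul ((h.comp (by fun_prop)).sub (h.comp (by fun_prop)))).add
    (contDiff_const.mul ((h.comp (by fun_prop)).sub (h.comp (by fun_prop))))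

theorem continuous_oddAngle (r : ℝ) : Continuous fun p : ℝ × ℝ => oddAngle r p.1 p.2 := by
  have h := Real.smoothTransition.continuous
  unfold oddAngle
  fun_prop

/-- Reflection exchanges the two transitions in each bracket. Oddness kills the sine integral, so
the chord is governed by the cosine integral alone. -/
theorem oddAngle_one_sub (r a x : ℝ) : oddAngle r a (1 - x) = -oddAngle r a x := by
  unfold oddAngle
  rw [show 8 * (1 - x - 1 / 2 - a) = 8 * (1 / 2 - x - a) by ring,
    show 8 * (1 / 2 - (1 - x) - a) = 8 * (x - 1 / 2 - a) by ring,
    show 8 * (1 - x - 7 / 8) = 8 * (1 / 8 - x) by ring,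
    show 8 * (1 / 8 - (1 - x)) = 8 * (x - 7 / 8) by ring]
  ring

/-- For `a ≤ 3 / 8` the first transition is complete at the endpoint and contributes `π`, which the
coefficient `r / 2 - π` of the second one corrects. -/
theorem oddAngle_one (r : ℝ) {a : ℝ} (ha : 0 ≤ a) (ha' : a ≤ 3 / 8) : oddAngle r a 1 = r / 2 := by
  unfold oddAngle
  rw [Real.smoothTransition.one_of_one_le (by linarith),
    Real.smoothTransition.zero_of_nonpos (by linarith),
    Real.smoothTransition.one_of_one_le (by linarith),
    Real.smoothTransition.zero_of_nonpos (by linarith)]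
  ring

theorem cos_oddAngle_zero (r : ℝ) {x : ℝ} (hx : x ∈ Icc (5 / 8 : ℝ) (7 / 8)) :
    Real.cos (oddAngle r 0 x) = -1 := by
  unfold oddAngle
  rw [Real.smoothTransition.one_of_one_le (by linarith [hx.1]),
    Real.smoothTransition.zero_of_nonpos (by linarith [hx.1]),
    Real.smoothTransition.zero_of_nonpos (by linarith [hx.2]),
    Real.smoothTransition.zero_of_nonpos (by linarith [hx.1])]
  simp

theorem cos_oddAngle_max (r : ℝ) {x : ℝ} (hx : x ∈ Icc (1 / 8 : ℝ) (7 / 8)) :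
    Real.cos (oddAngle r (3 / 8) x) = 1 := by
  unfold oddAngle
  rw [Real.smoothTransition.zero_of_nonpos (by linarith [hx.2]),
    Real.smoothTransition.zero_of_nonpos (by linarith [hx.1]),
    Real.smoothTransition.zero_of_nonpos (by linarith [hx.2]),
    Real.smoothTransition.zero_of_nonpos (by linarith [hx.1])]
  simp

/-- The signed distance between the ends of the unit length arc with angle `oddAngle r a`. -/
noncomputable def oddChord (r a : ℝ) : ℝ := ∫ x in (0 : ℝ)..1, Real.cos (oddAngle r a x)

theorem continuous_oddChord (r : ℝ) : Continuous (oddChord r) :=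
  intervalIntegral.continuous_parametric_intervalIntegral_of_continuous'
    (f := fun a x => Real.cos (oddAngle r a x))
    (Real.continuous_cos.comp (continuous_oddAngle r)) 0 1

theorem integral_le_mul_sub {f : ℝ → ℝ} (hf : Continuous f) {p q K : ℝ} (hpq : p ≤ q)
    (h : ∀ x ∈ Icc p q, f x ≤ K) : ∫ x in p..q, f x ≤ K * (q - p) := by
  refine (intervalIntegral.integral_mono_on (g := fun _ => K) hpq (hf.intervalIntegrable _ _)
    (by simp) h).trans_eq ?_
  simp [mul_comm]

/-- The cosine is `-1` on two intervals of total length `1 / 2` and at most 1 on the remaining half.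
-/
theorem oddChord_zero_le (r : ℝ) : oddChord r 0 ≤ 0 := by
  have hc : Continuous fun x => Real.cos (oddAngle r 0 x) :=
    Real.continuous_cos.comp (contDiff_oddAngle r 0).continuous
  have hi := fun p q : ℝ => hc.intervalIntegrable (μ := volume) p q
  have h1 := integral_le_mul_sub hc (p := 0) (q := 1 / 8) (by norm_num)
    fun x _ => Real.cos_le_one _
  have h2 := integral_le_mul_sub hc (p := 1 / 8) (q := 3 / 8) (K := -1) (by norm_num) fun x hx => by
    rw [← Real.cos_neg, ← oddAngle_one_sub, cos_oddAngle_zero r ⟨by linarith [hx.2],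
      by linarith [hx.1]⟩]
  have h3 := integral_le_mul_sub hc (p := 3 / 8) (q := 5 / 8) (by norm_num)
    fun x _ => Real.cos_le_one _
  have h4 := integral_le_mul_sub hc (p := 5 / 8) (q := 7 / 8) (K := -1) (by norm_num)
    fun x hx => (cos_oddAngle_zero r hx).le
  have h5 := integral_le_mul_sub hc (p := 7 / 8) (q := 1) (by norm_num)
    fun x _ => Real.cos_le_one _
  rw [oddChord, ← intervalIntegral.integral_add_adjacent_intervals (hi 0 (1 / 8)) (hi _ _),
    ← intervalIntegral.integral_add_adjacent_intervals (hi (1 / 8) (3 / 8)) (hi _ _),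
    ← intervalIntegral.integral_add_adjacent_intervals (hi (3 / 8) (5 / 8)) (hi _ _),
    ← intervalIntegral.integral_add_adjacent_intervals (hi (5 / 8) (7 / 8)) (hi _ _)]
  linarith

/-- The cosine is 1 on an interval of length `3 / 4` and at least `-1` elsewhere. -/
theorem oddChord_max_pos (r : ℝ) : 0 < oddChord r (3 / 8) := by
  have hc : Continuous fun x => Real.cos (oddAngle r (3 / 8) x) :=
    Real.continuous_cos.comp (contDiff_oddAngle r _).continuous
  have hn : Continuous fun x => -Real.cos (oddAngle r (3 / 8) x) := hc.neg
  have hi := fun p q : ℝ => hc.intervalIntegrable (μ := volume) p q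
  have h1 := integral_le_mul_sub hn (p := 0) (q := 1 / 8) (K := 1) (by norm_num)
    fun x _ => by linarith [Real.neg_one_le_cos (oddAngle r (3 / 8) x)]
  have h2 := integral_le_mul_sub hn (p := 1 / 8) (q := 7 / 8) (K := -1) (by norm_num)
    fun x hx => by rw [cos_oddAngle_max r hx]
  have h3 := integral_le_mul_sub hn (p := 7 / 8) (q := 1) (K := 1) (by norm_num)
    fun x _ => by linarith [Real.neg_one_le_cos (oddAngle r (3 / 8) x)]
  rw [intervalIntegral.integral_neg] at h1 h2 h3
  rw [oddChord, ← intervalIntegral.integral_add_adjacent_intervals (hi 0 (1 / 8)) (hi _ _),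
    ← intervalIntegral.integral_add_adjacent_intervals (hi (1 / 8) (7 / 8)) (hi _ _)]
  linarith

theorem integral_sin_oddAngle (r a : ℝ) : ∫ x in (0 : ℝ)..1, Real.sin (oddAngle r a x) = 0 := by
  have h := intervalIntegral.integral_comp_sub_left (a := 0) (b := 1)
    (fun x => Real.sin (oddAngle r a x)) 1
  simp only [oddAngle_one_sub, Real.sin_neg, intervalIntegral.integral_neg, sub_self,
    sub_zero] at h
  linarith

theorem isFeasible_oddAngle {ℓ r a L : ℝ} (ha : 0 ≤ a) (ha' : a ≤ 3 / 8) (hL : 0 < L)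
    (h : L * oddChord r a = ℓ) :
    IsFeasible ℓ r L (derivWithin (oddAngle r a) (Icc 0 1)) := by
  have hp := IsPrimitive.of_contDiffOn (contDiff_oddAngle r a).contDiffOn
  refine ⟨hL, memLp_of_continuousOn ((contDiff_oddAngle r a).contDiffOn.continuousOn_derivWithin
    (uniqueDiffOn_Icc zero_lt_one) le_rfl), ?_, ?_⟩
  · have h0 := oddAngle_one_sub r a 1
    rw [sub_self] at h0
    rw [hp.integral_eq_sub, h0, oddAngle_one r ha ha']
    ring
  · have hs := integral_sin_oddAngle r a
    rw [oddChord] at h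
    rw [intervalIntegral.integral_of_le zero_le_one, integral_Ioc_eq_integral_Ioo] at hs h
    rw [sq_add_sq_turning hp, hs, ← h]
    ring

/-- For `ℓ = 0` the intermediate value theorem in `a` gives a closed arc of length 1. For `ℓ > 0`
the arc with `a = 3 / 8` has a positive chord and is scaled to the required one. -/
theorem exists_isFeasible {ℓ : ℝ} (hℓ : 0 ≤ ℓ) (r : ℝ) : ∃ L v, IsFeasible ℓ r L v := by
  rcases hℓ.eq_or_lt with rfl | hpos
  · obtain ⟨a, ha, h0⟩ := intermediate_value_Icc (by norm_num : (0 : ℝ) ≤ 3 / 8)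
      (continuous_oddChord r).continuousOn ⟨oddChord_zero_le r, (oddChord_max_pos r).le⟩
    exact ⟨1, _, isFeasible_oddAngle ha.1 ha.2 one_pos (by rw [h0, mul_zero])⟩
  · have h := oddChord_max_pos r
    exact ⟨ℓ / oddChord r (3 / 8), _, isFeasible_oddAngle (by norm_num) le_rfl (by positivity)
      (div_mul_cancel₀ _ h.ne')⟩

/-! ### The direct method -/

theorem arcEnergy_nonneg {L : ℝ} (hL : 0 < L) (v : ℝ → ℝ) : 0 ≤ arcEnergy L v :=
  add_nonneg (div_nonneg (integral_nonneg fun _ => sq_nonneg _) hL.le) hL.le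

theorem exists_arcEnergy_minimizer {ℓ : ℝ} (hℓ : 0 ≤ ℓ) (r : ℝ) :
    ∃ L v, IsFeasible ℓ r L v ∧
      ∀ L' v', IsFeasible ℓ r L' v' → arcEnergy L v ≤ arcEnergy L' v' := by
  set S : Set ℝ := {e | ∃ L v, IsFeasible ℓ r L v ∧ arcEnergy L v = e} with hS
  have hne : S.Nonempty := by
    obtain ⟨L, v, h⟩ := exists_isFeasible hℓ r
    exact ⟨_, L, v, h, rfl⟩
  have hbdd : BddBelow S := ⟨0, by
    rintro _ ⟨L, v, h, rfl⟩
    exact arcEnergy_nonneg h.pos v⟩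
  obtain ⟨e, -, hlim, heS⟩ := exists_seq_tendsto_sInf hne hbdd
  set m := sInf S with hm
  choose L v hLv hE using heS
  obtain ⟨M, hM⟩ : ∃ M : ℝ, ∀ n, e n ≤ M := by
    obtain ⟨M, hM⟩ := hlim.bddAbove_range
    exact ⟨M, fun n => hM ⟨n, rfl⟩⟩
  set f : ℕ → Lp ℝ 2 (volume.restrict (Ioo (0 : ℝ) 1)) := fun n => (hLv n).memLp.toLp (v n) with hf
  have hfeas : ∀ n, IsFeasible ℓ r (L n) (f n) := fun n =>
    (hLv n).congr_ae (hLv n).memLp.coeFn_toLp.symm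
  have hEf : ∀ n, ‖f n‖ ^ 2 / L n + L n = e n := fun n => by
    rw [← hE n, ← arcEnergy_congr_ae (hLv n).memLp.coeFn_toLp, arcEnergy, integral_sq_eq_norm_sq]
  have hLpos := fun n => (hLv n).pos
  have hLM : ∀ n, L n ≤ M := fun n => by
    have : 0 ≤ ‖f n‖ ^ 2 / L n := div_nonneg (sq_nonneg _) (hLpos n).le
    linarith [hEf n, hM n]
  have hfM : ∀ n, ‖f n‖ ≤ M := fun n => by
    have h1 : ‖f n‖ ^ 2 / L n ≤ M := by linarith [hEf n, hM n, hLpos n]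
    rw [div_le_iff₀ (hLpos n)] at h1
    have hM0 : 0 ≤ M := (hLpos n).le.trans (hLM n)
    refine (sq_le_sq₀ (norm_nonneg _) hM0).1 (h1.trans ?_)
    rw [sq]
    exact mul_le_mul_of_nonneg_left (hLM n) hM0
  obtain ⟨L₁, hL₁, hlow⟩ : ∃ c : ℝ, 0 < c ∧ ∀ n, c ≤ L n := by
    rcases hℓ.eq_or_lt with rfl | hpos
    · have hM0 : 0 < M := (hLpos 0).trans_le (hLM 0)
      refine ⟨M⁻¹, by positivity, fun n => ?_⟩
      refine inv_le_of_inv_le₀ (hLpos n) (((hLv n).inv_le_arcEnergy).trans ?_)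
      rw [hE n]
      exact hM n
    · exact ⟨ℓ, hpos, fun n => (hLv n).le_length hℓ⟩
  -- Finiteness of the exponent gives separability of `L²`, required for weak sequential
  -- compactness.
  have : Fact ((2 : ENNReal) ≠ ⊤) := ⟨by simp⟩
  obtain ⟨g, φ, hφ, hweak⟩ := exists_weakly_convergent_subseq hfM
  obtain ⟨Λ, hΛ, ψ, hψ, hLlim⟩ := isCompact_Icc.tendsto_subseq
    (x := fun n => L (φ n)) (fun n => ⟨hlow (φ n), hLM (φ n)⟩)
  have hΛpos : 0 < Λ := hL₁.trans_le hΛ.1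
  set σ : ℕ → ℕ := φ ∘ ψ with hσ
  have hw : ∀ w, Tendsto (fun n => inner ℝ (f (σ n)) w) atTop (𝓝 (inner ℝ g w)) := fun w =>
    (hweak w).comp hψ.tendsto_atTop
  have helim : Tendsto (fun n => e (σ n)) atTop (𝓝 m) :=
    hlim.comp (hφ.comp hψ).tendsto_atTop
  have hturn : ∀ x ∈ Icc (0 : ℝ) 1,
      Tendsto (fun n => turning (f (σ n)) x) atTop (𝓝 (turning g x)) := fun x hx => by
    simp only [turning_eq_inner _ hx]
    exact hw _
  have hint : ∀ Φ : ℝ → ℝ, Continuous Φ → (∀ y, |Φ y| ≤ 1) →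
      Tendsto (fun n => ∫ x in Ioo (0 : ℝ) 1, Φ (turning (f (σ n)) x)) atTop
        (𝓝 (∫ x in Ioo (0 : ℝ) 1, Φ (turning g x))) := by
    intro Φ hΦ hb
    refine tendsto_integral_of_dominated_convergence (fun _ => 1) (fun n => ?_)
      (integrable_const _) (fun n => .of_forall fun x => hb _) ?_
    · exact (integrableOn_of_continuousOn (hΦ.comp_continuousOn
        (continuousOn_turning (Lp.memLp (f (σ n)))))).aestronglyMeasurable
    · filter_upwards [ae_restrict_mem measurableSet_Ioo] with x hx
      exact (hΦ.tendsto _).comp (hturn x (Ioo_subset_Icc_self hx))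
  have hfeasg : IsFeasible ℓ r Λ g := by
    refine ⟨hΛpos, Lp.memLp g, ?_, ?_⟩
    · have h1 := hturn 1 (by simp)
      have h2 : ∀ u : ℝ → ℝ, turning u 1 = ∫ x in Ioo (0 : ℝ) 1, u x := fun u => by
        rw [turning, intervalIntegral.integral_of_le zero_le_one, integral_Ioc_eq_integral_Ioo]
      simp only [h2, (hfeas _).integral_eq] at h1
      exact (tendsto_nhds_unique h1 tendsto_const_nhds)
    · have h1 := (hLlim.pow 2).mul (((hint _ Real.continuous_cos Real.abs_cos_le_one).pow 2).add
        ((hint _ Real.continuous_sin Real.abs_sin_le_one).pow 2))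
      refine tendsto_nhds_unique h1 (tendsto_const_nhds.congr fun n => ?_)
      exact (hfeas (σ n)).chord.symm
  refine ⟨Λ, g, hfeasg, fun L' v' h' => ?_⟩
  refine le_trans ?_ (csInf_le hbdd ⟨L', v', h', rfl⟩)
  rw [arcEnergy, integral_sq_eq_norm_sq]
  -- Expanding `‖f - g‖² ≥ 0` bounds `‖f‖²` below by an expression affine in `f`, which passes to
  -- the weak limit. This gives lower semicontinuity even with the varying length in the
  -- denominator.
  have hlow2 : Tendsto (fun n => (2 * inner ℝ (f (σ n)) g - ‖g‖ ^ 2) / L (σ n) + L (σ n)) atTop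
      (𝓝 ((2 * inner ℝ g g - ‖g‖ ^ 2) / Λ + Λ)) :=
    ((((hw g).const_mul 2).sub_const _).div hLlim hΛpos.ne').add hLlim
  rw [real_inner_self_eq_norm_sq] at hlow2
  have hle := le_of_tendsto_of_tendsto' hlow2 helim fun n => by
    rw [← hEf (σ n)]
    have h1 : 2 * inner ℝ (f (σ n)) g - ‖g‖ ^ 2 ≤ ‖f (σ n)‖ ^ 2 := by
      have := norm_sub_sq_real (f (σ n)) g
      nlinarith [sq_nonneg ‖f (σ n) - g‖]
    have := hLpos (σ n)
    gcongr
  rwa [show 2 * ‖g‖ ^ 2 - ‖g‖ ^ 2 = ‖g‖ ^ 2 by ring] at hle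

/-! ### From curves to feasible arcs -/

/-- Reparametrisation proportional to arclength of an angle function `θ` along a curve with
speed `s`. -/
theorem exists_arclength_reparam {θ w s : ℝ → ℝ} (hθ : IsPrimitive θ w)
    (hw : MemLp w 2 (volume.restrict (Ioo (0 : ℝ) 1))) (hs : ContinuousOn s (Icc 0 1))
    (hpos : ∀ x ∈ Icc (0 : ℝ) 1, 0 < s x) :
    0 < ∫ x in Ioo (0 : ℝ) 1, s x ∧
    ∃ Θ v : ℝ → ℝ, IsPrimitive Θ v ∧ MemLp v 2 (volume.restrict (Ioo (0 : ℝ) 1)) ∧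
      Θ 0 = θ 0 ∧ Θ 1 = θ 1 ∧
      ∫ x in Ioo (0 : ℝ) 1, v x ^ 2
        = (∫ x in Ioo (0 : ℝ) 1, s x) * ∫ x in Ioo (0 : ℝ) 1, w x ^ 2 / s x ∧
      ∀ F : ℝ → ℝ, (∫ x in Ioo (0 : ℝ) 1, s x) * ∫ x in Ioo (0 : ℝ) 1, F (Θ x)
        = ∫ x in Ioo (0 : ℝ) 1, s x * F (θ x) := by
  have hsi : IntervalIntegrable s volume 0 1 :=
    ContinuousOn.intervalIntegrable (by rwa [uIcc_of_le zero_le_one])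
  have hL : 0 < ∫ x in Ioo (0 : ℝ) 1, s x := by
    rw [← integral_Ioc_eq_integral_Ioo, ← intervalIntegral.integral_of_le zero_le_one]
    exact intervalIntegral.intervalIntegral_pos_of_pos_on hsi
      (fun x hx => hpos x (Ioo_subset_Icc_self hx)) zero_lt_one
  refine ⟨hL, ?_⟩
  set L : ℝ := ∫ x in Ioo (0 : ℝ) 1, s x with hLdef
  set σ : ℝ → ℝ := fun x => (∫ t in (0 : ℝ)..x, s t) / L with hσ
  have hσ0 : σ 0 = 0 := by simp [hσ]
  have hσ1 : σ 1 = 1 := by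
    simp only [hσ]
    rw [intervalIntegral.integral_of_le zero_le_one, integral_Ioc_eq_integral_Ioo, div_self hL.ne']
  have hσc : ContinuousOn σ (Icc 0 1) := by
    have := (IsPrimitive.of_integral 0 hsi).continuousOn
    simp only [zero_add] at this
    exact this.div_const L
  have hσd : ∀ x ∈ Ioo (0 : ℝ) 1, HasDerivAt σ (s x / L) x := fun x hx => by
    refine HasDerivAt.div_const (intervalIntegral.integral_hasDerivAt_right
      (hsi.mono_set ?_) ?_ ?_) L
    · rw [uIcc_of_le hx.1.le, uIcc_of_le zero_le_one]
      exact Icc_subset_Icc_right hx.2.le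
    · exact (hs.mono Ioo_subset_Icc_self).stronglyMeasurableAtFilter isOpen_Ioo x hx
    · exact hs.continuousAt (Icc_mem_nhds hx.1 hx.2)
  have hmono : StrictMonoOn σ (Icc 0 1) := by
    refine strictMonoOn_of_deriv_pos (convex_Icc 0 1) hσc fun x hx => ?_
    rw [interior_Icc] at hx
    rw [(hσd x hx).deriv]
    exact div_pos (hpos x (Ioo_subset_Icc_self hx)) hL
  have hsurj : ∀ y ∈ Icc (0 : ℝ) 1, ∃ x ∈ Icc (0 : ℝ) 1, σ x = y := fun y hy => by
    have := intermediate_value_Icc zero_le_one hσc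
    rw [hσ0, hσ1] at this
    exact this hy
  have himage : ∀ y ∈ Icc (0 : ℝ) 1, σ '' Ioo 0 y = Ioo 0 (σ y) := by
    intro y hy
    have h0 : (0 : ℝ) ∈ Icc (0 : ℝ) 1 := by simp
    ext z
    constructor
    · rintro ⟨x, hx, rfl⟩
      have hx' : x ∈ Icc (0 : ℝ) 1 := ⟨hx.1.le, hx.2.le.trans hy.2⟩
      have h1 := hmono h0 hx' hx.1
      rw [hσ0] at h1
      exact ⟨h1, hmono hx' hy hx.2⟩
    · intro hz
      have hσy : σ y ≤ 1 := by
        rw [← hσ1]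
        exact hmono.monotoneOn hy (by simp) hy.2
      obtain ⟨x, hx, rfl⟩ := hsurj z ⟨hz.1.le, hz.2.le.trans hσy⟩
      refine ⟨x, ⟨?_, (hmono.lt_iff_lt hx hy).1 hz.2⟩, rfl⟩
      rw [← hσ0] at hz
      exact (hmono.lt_iff_lt h0 hx).1 hz.1
  have himage1 : σ '' Ioo 0 1 = Ioo 0 1 := by
    rw [himage 1 (by simp), hσ1]
  have hsub : ∀ y ∈ Icc (0 : ℝ) 1, Ioo 0 y ⊆ Ioo (0 : ℝ) 1 := fun y hy =>
    Ioo_subset_Ioo_right hy.2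
  have habs : ∀ x ∈ Ioo (0 : ℝ) 1, |s x / L| = s x / L := fun x hx =>
    abs_of_pos (div_pos (hpos x (Ioo_subset_Icc_self hx)) hL)
  -- The substitution is needed on every `(0, σ y)`, not just on the whole interval, to identify `Θ`
  -- as a primitive of `v` at each point.
  have hcov : ∀ y ∈ Icc (0 : ℝ) 1, ∀ G : ℝ → ℝ,
      ∫ x in Ioo 0 (σ y), G x = ∫ x in Ioo 0 y, s x / L * G (σ x) := by
    intro y hy G
    rw [← himage y hy, integral_image_eq_integral_abs_deriv_smul measurableSet_Ioo
      (fun x hx => (hσd x (hsub y hy hx)).hasDerivWithinAt)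
      (hmono.injOn.mono ((hsub y hy).trans Ioo_subset_Icc_self))]
    refine setIntegral_congr_fun measurableSet_Ioo fun x hx => ?_
    simp only [habs x (hsub y hy hx), smul_eq_mul]
  have hcov1 : ∀ G : ℝ → ℝ,
      ∫ x in Ioo (0 : ℝ) 1, G x = ∫ x in Ioo (0 : ℝ) 1, s x / L * G (σ x) := fun G => by
    simpa only [hσ1] using hcov 1 (by simp) G
  have hcovi : ∀ G H : ℝ → ℝ, IntegrableOn H (Ioo 0 1) →
      (∀ x ∈ Ioo (0 : ℝ) 1, s x / L * G (σ x) = H x) → IntegrableOn G (Ioo 0 1) := by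
    intro G H hH hGH
    rw [← himage1, integrableOn_image_iff_integrableOn_abs_deriv_smul measurableSet_Ioo
      (fun x hx => (hσd x hx).hasDerivWithinAt) (hmono.injOn.mono Ioo_subset_Icc_self)]
    refine hH.congr_fun (fun x hx => ?_) measurableSet_Ioo
    simp only [habs x hx, smul_eq_mul, hGH x hx]
  set τ : ℝ → ℝ := Function.invFunOn σ (Icc 0 1) with hτ
  have hτσ : ∀ x ∈ Icc (0 : ℝ) 1, τ (σ x) = x := fun x hx =>
    hmono.injOn.leftInvOn_invFunOn hx
  -- The derivative of `θ ∘ τ`: the inverse `τ` of `σ` has derivative `L / s (τ y)`.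
  set v : ℝ → ℝ := fun y => w (τ y) * L / s (τ y) with hv
  have hvσ : ∀ x ∈ Icc (0 : ℝ) 1, s x / L * v (σ x) = w x := fun x hx => by
    have := hpos x hx
    simp only [hv, hτσ x hx]
    field_simp
  have hv2σ : ∀ x ∈ Icc (0 : ℝ) 1, s x / L * v (σ x) ^ 2 = L * (w x ^ 2 / s x) := fun x hx => by
    have := hpos x hx
    simp only [hv, hτσ x hx]
    field_simp
  have hwi : IntegrableOn w (Ioo 0 1) := hw.integrable one_le_two
  have hw2 : IntegrableOn (fun x => L * (w x ^ 2 / s x)) (Ioo 0 1) := by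
    have h1 : MemLp (fun x => (s x)⁻¹ * w x) 2 (volume.restrict (Ioo (0 : ℝ) 1)) :=
      memLp_continuousOn_mul (hs.inv₀ fun x hx => (hpos x hx).ne') hw
    have h2 : Integrable (fun x => w x * ((s x)⁻¹ * w x)) (volume.restrict (Ioo (0 : ℝ) 1)) :=
      hw.integrable_mul h1
    refine (h2.const_mul L).congr (.of_forall fun x => ?_)
    simp only
    ring
  have hvi : IntegrableOn v (Ioo 0 1) :=
    hcovi v w hwi fun x hx => hvσ x (Ioo_subset_Icc_self hx)
  have hv2i : IntegrableOn (fun x => v x ^ 2) (Ioo 0 1) :=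
    hcovi (fun x => v x ^ 2) _ hw2 fun x hx => hv2σ x (Ioo_subset_Icc_self hx)
  have hτ0 : τ 0 = 0 := by simpa only [hσ0] using hτσ 0 (by simp)
  have hτ1 : τ 1 = 1 := by simpa only [hσ1] using hτσ 1 (by simp)
  refine ⟨fun y => θ (τ y), v,
    ⟨(intervalIntegrable_iff_integrableOn_Ioo_of_le zero_le_one).2 hvi, ?_⟩,
    (memLp_two_iff_integrable_sq hvi.aestronglyMeasurable).2 hv2i, by simp only [hτ0],
    by simp only [hτ1], ?_, fun F => ?_⟩
  · intro y hy
    obtain ⟨x, hx, rfl⟩ := hsurj y hy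
    simp only [hτσ x hx, hτ0]
    rw [intervalIntegral.integral_of_le hy.1, integral_Ioc_eq_integral_Ioo, hcov x hx,
      hθ.eq_add_integral x hx, intervalIntegral.integral_of_le hx.1, integral_Ioc_eq_integral_Ioo]
    congr 1
    exact (setIntegral_congr_fun measurableSet_Ioo fun t ht =>
      hvσ t (Ioo_subset_Icc_self (hsub x hx ht))).symm
  · rw [hcov1, ← integral_const_mul]
    exact setIntegral_congr_fun measurableSet_Ioo fun t ht => hv2σ t (Ioo_subset_Icc_self ht)
  · rw [hcov1, ← integral_const_mul]
    refine setIntegral_congr_fun measurableSet_Ioo fun t ht => ?_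
    simp only [hτσ t (Ioo_subset_Icc_self ht)]
    field_simp

/-- Arclength reparametrisation keeps the end values of the angle, hence the total curvature. Its
substitution rule with cosine and sine recovers the chord vector `(ℓ, 0)`. -/
theorem exists_isFeasible_of_mem_admissibleTC {ℓ r : ℝ} {η : ℝ → Plane}
    (h : η ∈ admissibleTC ℓ r) : ∃ L v, IsFeasible ℓ r L v ∧ arcEnergy L v = energy η := by
  obtain ⟨⟨hη, h0, h1⟩, hTC⟩ := h
  have hang := isTangentialAngle_tangentialAngle hη
  set θ := tangentialAngle η
  have hcont : ContinuousOn (fun x => ‖velocity η x‖) (Icc 0 1) :=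
    (continuousOn_velocity hη.2.1).norm
  obtain ⟨hL, Θ, v, hΘ, hv, hΘ0, hΘ1, hsq, hF⟩ := exists_arclength_reparam hang.isPrimitive
    hang.1.weakDeriv.2 hcont fun x hx => norm_velocity_pos hη hx
  change 0 < length η at hL
  change _ = length η * _ at hsq
  change ∀ F : ℝ → ℝ, length η * _ = _ at hF
  refine ⟨length η, v, ⟨hL, hv, ?_, ?_⟩, ?_⟩
  · rw [hΘ.integral_eq_sub, hΘ0, hΘ1, ← hang.isPrimitive.integral_eq_sub,
      ← hang.totalCurvature_eq hη, hTC]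
  · have hx := hF Real.cos
    have hy := hF Real.sin
    have ex : ∫ x in Ioo (0 : ℝ) 1, ‖velocity η x‖ * Real.cos (θ x) = ℓ := by
      have := (isPrimitive_coord hη.2.1 0).integral_eq_sub
      rw [h0, h1] at this
      simp only [Matrix.cons_val_zero, sub_zero] at this
      refine Eq.trans ?_ this
      refine setIntegral_congr_fun measurableSet_Ioo fun x hx => ?_
      have e := congrArg (fun z : Plane => z 0) (hang.velocity_eq (Ioo_subset_Icc_self hx))
      simpa using e.symm
    have ey : ∫ x in Ioo (0 : ℝ) 1, ‖velocity η x‖ * Real.sin (θ x) = 0 := by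
      have := (isPrimitive_coord hη.2.1 1).integral_eq_sub
      rw [h0, h1] at this
      simp only [Matrix.cons_val_one, Matrix.cons_val_fin_one, sub_zero] at this
      refine Eq.trans ?_ this
      refine setIntegral_congr_fun measurableSet_Ioo fun x hx => ?_
      have e := congrArg (fun z : Plane => z 1) (hang.velocity_eq (Ioo_subset_Icc_self hx))
      simpa using e.symm
    rw [ex] at hx
    rw [ey] at hy
    rw [sq_add_sq_turning hΘ, mul_add, ← mul_pow, ← mul_pow, hx, hy]
    ring
  · rw [arcEnergy, energy, hsq, hang.bendingEnergy_eq hη, mul_div_cancel_left₀ _ hL.ne']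

/-! ### From feasible arcs to curves -/

/-- The curve starting at the origin, of constant speed `L` and with tangential angle `θ`. -/
noncomputable def curveOfAngle (L : ℝ) (θ : ℝ → ℝ) (x : ℝ) : Plane :=
  ∫ t in (0 : ℝ)..x, L • !₂[Real.cos (θ t), Real.sin (θ t)]

section CurveOfAngle

variable {L : ℝ} {θ v : ℝ → ℝ}

theorem continuous_tangent (hθ : Continuous θ) :
    Continuous fun t => (L • !₂[Real.cos (θ t), Real.sin (θ t)] : Plane) := by
  refine Continuous.const_smul ?_ L
  refine (PiLp.continuous_toLp 2 _).comp (continuous_pi fun i => ?_)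
  fin_cases i
  · exact Real.continuous_cos.comp hθ
  · exact Real.continuous_sin.comp hθ

theorem hasDerivAt_curveOfAngle (hθ : Continuous θ) (x : ℝ) :
    HasDerivAt (curveOfAngle L θ) (L • !₂[Real.cos (θ x), Real.sin (θ x)]) x :=
  ((continuous_tangent hθ).integral_hasStrictDerivAt 0 x).hasDerivAt

theorem contDiff_curveOfAngle (hθ : Continuous θ) : ContDiff ℝ 1 (curveOfAngle L θ) := by
  rw [contDiff_one_iff_deriv]
  refine ⟨fun x => (hasDerivAt_curveOfAngle hθ x).differentiableAt, ?_⟩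
  rw [show deriv (curveOfAngle L θ) = _ from
    funext fun x => (hasDerivAt_curveOfAngle hθ x).deriv]
  exact continuous_tangent hθ

theorem velocity_curveOfAngle (hθ : Continuous θ) {x : ℝ} (hx : x ∈ Icc (0 : ℝ) 1) :
    velocity (curveOfAngle L θ) x = L • !₂[Real.cos (θ x), Real.sin (θ x)] :=
  (hasDerivAt_curveOfAngle hθ x).hasDerivWithinAt.derivWithin (uniqueDiffOn_Icc zero_lt_one x hx)

theorem norm_velocity_curveOfAngle (hL : 0 < L) (hθ : Continuous θ) {x : ℝ}
    (hx : x ∈ Icc (0 : ℝ) 1) : ‖velocity (curveOfAngle L θ) x‖ = L := by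
  rw [velocity_curveOfAngle hθ hx, norm_smul, norm_plane]
  simp [abs_of_pos hL]

theorem curveOfAngle_mem_H2Imm (hL : 0 < L) (hθ : Continuous θ) (h : IsPrimitive θ v)
    (hv : MemLp v 2 (volume.restrict (Ioo (0 : ℝ) 1))) : curveOfAngle L θ ∈ H2Imm := by
  have hC := contDiff_curveOfAngle (L := L) hθ
  have hG := continuous_tangent (L := L) hθ
  have hcos := Real.continuous_cos.comp_continuousOn h.continuousOn
  have hsin := Real.continuous_sin.comp_continuousOn h.continuousOn
  refine ⟨⟨memLp_of_coord fun i =>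
      memLp_of_continuousOn (continuousOn_coord hC.continuous.continuousOn i),
      fun t => L • !₂[Real.cos (θ t), Real.sin (θ t)], ?_, ?_, ?_⟩, hC.contDiffOn,
    L, hL, fun x hx => (norm_velocity_curveOfAngle hL hθ hx).ge⟩
  · refine IsWeakDeriv.of_coord fun i => .of_isPrimitive ?_
    refine (isPrimitive_coord hC.contDiffOn i).congr_right fun x hx => ?_
    rw [velocity_curveOfAngle hθ hx]
  · exact memLp_of_coord fun i =>
      memLp_of_continuousOn (continuousOn_coord hG.continuousOn i)
  · refine ⟨fun t => !₂[L * (-Real.sin (θ t) * v t), L * (Real.cos (θ t) * v t)],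
      IsWeakDeriv.of_coord fun i => ?_, memLp_of_coord fun i => ?_⟩
    · fin_cases i
      · simpa using (IsWeakDeriv.of_isPrimitive
          (h.comp Real.hasDerivAt_cos (by fun_prop))).clm_comp
          (L • ContinuousLinearMap.id ℝ ℝ)
      · simpa using (IsWeakDeriv.of_isPrimitive
          (h.comp Real.hasDerivAt_sin (by fun_prop))).clm_comp
          (L • ContinuousLinearMap.id ℝ ℝ)
    · fin_cases i
      · exact (memLp_continuousOn_mul hsin.neg hv).const_mul L
      · exact (memLp_continuousOn_mul hcos hv).const_mul L

theorem isTangentialAngle_curveOfAngle (hL : 0 < L) (hθ : Continuous θ) (h : IsPrimitive θ v)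
    (hv : MemLp v 2 (volume.restrict (Ioo (0 : ℝ) 1))) :
    IsTangentialAngle (curveOfAngle L θ) θ := by
  refine ⟨.of_isPrimitive h hv, h.continuousOn, fun x hx => ?_⟩
  rw [unitTangent, norm_velocity_curveOfAngle hL hθ hx, velocity_curveOfAngle hθ hx, smul_smul,
    inv_mul_cancel₀ hL.ne', one_smul]

theorem totalCurvature_curveOfAngle (hL : 0 < L) (hθ : Continuous θ) (h : IsPrimitive θ v)
    (hv : MemLp v 2 (volume.restrict (Ioo (0 : ℝ) 1))) :
    totalCurvature (curveOfAngle L θ) = ∫ x in Ioo (0 : ℝ) 1, v x := by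
  rw [(isTangentialAngle_curveOfAngle hL hθ h hv).totalCurvature_eq
    (curveOfAngle_mem_H2Imm hL hθ h hv)]
  exact integral_congr_ae (weakDeriv_ae_eq (.of_isPrimitive h))

theorem energy_curveOfAngle (hL : 0 < L) (hθ : Continuous θ) (h : IsPrimitive θ v)
    (hv : MemLp v 2 (volume.restrict (Ioo (0 : ℝ) 1))) :
    energy (curveOfAngle L θ) = arcEnergy L v := by
  have hlen : length (curveOfAngle L θ) = L := by
    rw [length, setIntegral_congr_fun (g := fun _ => L) measurableSet_Ioo fun x hx =>
      norm_velocity_curveOfAngle hL hθ (Ioo_subset_Icc_self hx)]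
    simp
  rw [energy, hlen, arcEnergy, (isTangentialAngle_curveOfAngle hL hθ h hv).bendingEnergy_eq
    (curveOfAngle_mem_H2Imm hL hθ h hv), ← integral_div]
  congr 1
  refine integral_congr_ae ?_
  filter_upwards [weakDeriv_ae_eq (IsWeakDeriv.of_isPrimitive h),
    ae_restrict_mem measurableSet_Ioo] with x e hx
  rw [e, norm_velocity_curveOfAngle hL hθ (Ioo_subset_Icc_self hx)]

end CurveOfAngle

theorem IsFeasible.exists_mem_admissibleTC {ℓ r L : ℝ} {v : ℝ → ℝ} (h : IsFeasible ℓ r L v)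
    (hℓ : 0 ≤ ℓ) : ∃ γ ∈ admissibleTC ℓ r, energy γ = arcEnergy L v := by
  -- Only the values of `v` on `(0, 1)` matter; extending it by zero makes `turning v` continuous on
  -- the whole line.
  wlog hv : Integrable v generalizing v
  · have hae : v =ᵐ[volume.restrict (Ioo (0 : ℝ) 1)] (Ioo (0 : ℝ) 1).indicator v :=
      (indicator_ae_eq_restrict measurableSet_Ioo).symm
    rw [arcEnergy_congr_ae hae]
    exact this (h.congr_ae hae) ((integrable_indicator_iff measurableSet_Ioo).2
      (h.memLp.integrable one_le_two))
  have hL := h.pos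
  have hcont : Continuous (turning v) :=
    intervalIntegral.continuous_primitive (fun a b => hv.intervalIntegrable) 0
  set C : ℝ := ∫ x in Ioo (0 : ℝ) 1, Real.cos (turning v x) with hC
  set S : ℝ := ∫ x in Ioo (0 : ℝ) 1, Real.sin (turning v x) with hS
  -- `α` is the direction of the chord when the initial angle is zero, so starting at `-α` turns the
  -- chord onto the positive axis. If the chord vanishes, `R = 0` and the default argument is
  -- harmless.
  set α : ℝ := Complex.arg ⟨C, S⟩ with hα
  set R : ℝ := ‖(⟨C, S⟩ : ℂ)‖ with hR
  have hRC : C = R * Real.cos α := (Complex.norm_mul_cos_arg ⟨C, S⟩).symm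
  have hRS : S = R * Real.sin α := (Complex.norm_mul_sin_arg ⟨C, S⟩).symm
  have hchord := h.chord
  rw [← hC, ← hS] at hchord
  -- The chord condition only fixes squares; `ℓ ≥ 0` selects the sign.
  have hLR : L * R = ℓ := by
    refine (sq_eq_sq₀ (by positivity) hℓ).1 ?_
    rw [← hchord, hRC, hRS]
    linear_combination (-1) * L ^ 2 * R ^ 2 * Real.sin_sq_add_cos_sq α
  set θ : ℝ → ℝ := fun x => -α + turning v x with hθ
  have hθc : Continuous θ := by fun_prop
  have hp : IsPrimitive θ v := IsPrimitive.of_integral (-α) hv.intervalIntegrable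
  have hci : IntegrableOn (fun x => Real.cos (turning v x)) (Ioo 0 1) :=
    integrableOn_of_continuousOn (Real.continuous_cos.comp hcont).continuousOn
  have hsi : IntegrableOn (fun x => Real.sin (turning v x)) (Ioo 0 1) :=
    integrableOn_of_continuousOn (Real.continuous_sin.comp hcont).continuousOn
  have ecos : ∫ x in Ioo (0 : ℝ) 1, Real.cos (θ x) = R := by
    simp only [hθ, Real.cos_add, Real.cos_neg, Real.sin_neg]
    rw [integral_sub (hci.const_mul _) (hsi.const_mul _), integral_const_mul, integral_const_mul,
      ← hC, ← hS, hRC, hRS]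
    linear_combination R * Real.sin_sq_add_cos_sq α
  have esin : ∫ x in Ioo (0 : ℝ) 1, Real.sin (θ x) = 0 := by
    simp only [hθ, Real.sin_add, Real.cos_neg, Real.sin_neg]
    rw [integral_add (hci.const_mul _) (hsi.const_mul _), integral_const_mul, integral_const_mul,
      ← hC, ← hS, hRC, hRS]
    ring
  have hmem := curveOfAngle_mem_H2Imm hL hθc hp h.memLp
  have h0 : curveOfAngle L θ 0 = 0 := by simp [curveOfAngle]
  refine ⟨curveOfAngle L θ, ⟨⟨hmem, ?_, ?_⟩, ?_⟩, energy_curveOfAngle hL hθc hp h.memLp⟩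
  · rw [h0]
    ext i
    fin_cases i <;> simp
  · have hcoord := fun i => (isPrimitive_coord hmem.2.1 i).integral_eq_sub
    have hvel : ∀ i, ∫ x in Ioo (0 : ℝ) 1, velocity (curveOfAngle L θ) x i
        = ∫ x in Ioo (0 : ℝ) 1, L * (!₂[Real.cos (θ x), Real.sin (θ x)] : Plane) i := fun i =>
      setIntegral_congr_fun measurableSet_Ioo fun x hx => by
        simp only [velocity_curveOfAngle hθc (Ioo_subset_Icc_self hx), PiLp.smul_apply, smul_eq_mul]
    simp only [h0, PiLp.zero_apply, sub_zero, hvel, integral_const_mul] at hcoord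
    ext i
    rw [← hcoord i]
    fin_cases i
    · simp [ecos, hLR]
    · simp [esin]
  · rw [totalCurvature_curveOfAngle hL hθc hp h.memLp, h.integral_eq]

end PlanarElastica

theorem proposition2 (ℓ r : ℝ) (hℓ : 0 ≤ ℓ) :
    ∃ γ ∈ PlanarElastica.admissibleTC ℓ r,
      ∀ η ∈ PlanarElastica.admissibleTC ℓ r,
        PlanarElastica.energy γ ≤ PlanarElastica.energy η := by
  obtain ⟨L, v, hLv, hmin⟩ := PlanarElastica.exists_arcEnergy_minimizer hℓ r
  obtain ⟨γ, hγ, hE⟩ := hLv.exists_mem_admissibleTC hℓ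
  refine ⟨γ, hγ, fun η hη => ?_⟩
  obtain ⟨L', v', h', hE'⟩ := PlanarElastica.exists_isFeasible_of_mem_admissibleTC hη
  rw [hE, ← hE']
  exact hmin L' v' h'
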